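/- Model. A base station (BS) with $T_c$ antennas sits at the origin of $\mathbb{R}^2$ and serves $U_c$ single-antenna cellular users, $1\le U_c\le T_c$. The typical cellular user (index $0$) is uniformly distributed in the closed disc of radius $R>0$ around the origin; $D_{0,\mathrm{BS}}$ is its distance to the BS. The channels $\mathbf h_0,\dots,\mathbf h_{U_c-1}\in\mathbb{C}^{T_c}$ are i.i.d. $\mathcal{CN}(\mathbf 0,\mathbf I)$, and the zero-forcing precoding vector $\mathbf v_0$ is the column of index $0$ of $\mathbf H(\mathbf H^H\mathbf H)^{-1}$, $\mathbf H=[\mathbf h_0,\dots,\mathbf h_{U_c-1}]$, normalized to unit Euclidean norm. Device-to-device transmitters form a homogeneous Poisson point process in $\mathbb{R}^2$ of density $\lambda_d>0$; the $j$-th one is at distance $D_{0,j}$ from the typical cellular user and has fading coefficient $e_{0,j}\sim\mathcal{CN}(0,1)$, the $e_{0,j}$ being i.i.d. The user location, the point process, the channels $(\mathbf h_j)_j$ and the fading $(e_{0,j})_j$ are mutually independent. Let $P_c,P_d,A_{0,c},A_{0,d}>0$ (BS power, device power, pathloss coefficients), $\alpha_c>0$ and $\alpha_d>2$ (pathloss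 exponents), $N_0\ge 0$ (noise power), $\zeta=A_{0,c}P_c/U_c$, and $$\mathrm{SINR}_{c,0}=\frac{|\mathbf h_0^H\mathbf v_0|^2}{\frac{A_{0,d}}{\zeta}D_{0,\mathrm{BS}}^{\alpha_c}\big(I_{d,c}+\frac{N_0}{A_{0,d}}\big)},\qquad I_{d,c}=\sum_j P_d D_{0,j}^{-\alpha_d}|e_{0,j}|^2 .$$ Proposition. For every threshold $\beta_c\ge 0$, the coverage probability $\mathrm{P}^c_{\mathrm{succ}}=\Pr\{\mathrm{SINR}_{c,0}\ge\beta_c\}$ of the typical cellular user is $$\mathrm{P}^c_{\mathrm{succ}}=\mathbb{E}_{D_{0,\mathrm{BS}}}\Bigg[e^{-s\frac{N_0}{A_{0,d}}}\sum_{k=0}^{T_c-U_c}\frac{s^k}{k!}\sum_{i=0}^{k}\binom ki\Big(\frac{N_0}{A_{0,d}}\Big)^{k-i}(-1)^i\frac{\mathrm d^i}{\mathrm ds^i}\exp\Big(-\frac{\pi\lambda_d}{\mathrm{sinc}(2/\alpha_d)}(sP_d)^{2/\alpha_d}\Big)\Bigg],$$ where $s=\frac{\beta_c}{\zeta}A_{0,d}D_{0,\mathrm{BS}}^{\alpha_c}$,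 $\mathrm{sinc}(z)=\frac{\sin(\pi z)}{\pi z}$, the random variable in brackets is integrable, and where $s=0$ the terms with $k\ge1$ are read as $0$. -/

import Mathlib

open MeasureTheory ProbabilityTheory
open scoped ENNReal Matrix

noncomputable section

/-- The plane in which the base station (at the origin) and the users are located. -/
abbrev Plane : Type := EuclideanSpace ℝ (Fin 2)

/-- The circularly symmetric complex Gaussian law `CN(0,1)`: real and imaginary parts are
independent real Gaussians of mean `0` and variance `1/2`. -/
def complexGaussian : Measure ℂ :=
  ((gaussianReal 0 (1 / 2)).prod (gaussianReal 0 (1 / 2))).map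
    (fun p : ℝ × ℝ => (p.1 : ℂ) + (p.2 : ℂ) * Complex.I)

/-- The law `CN(0, I)` on `ℂ^T`: independent `CN(0,1)` coordinates. -/
def complexGaussianVec (T : ℕ) : Measure (Fin T → ℂ) :=
  Measure.pi (fun _ => complexGaussian)

/-- The number (possibly infinite) of points of a sequence that lie in `B`. -/
def pointCount {Ω : Type*} (x : ℕ → Ω → Plane) (B : Set Plane) (ω : Ω) : ℕ∞ :=
  Set.encard {j : ℕ | x j ω ∈ B}

/-- The points `x 0, x 1, …` form a homogeneous Poisson point process in the plane with density
`lam`: the number of points in a bounded Borel set `B` is Poisson with mean `lam * area B`, and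
the numbers of points in finitely many pairwise disjoint bounded Borel sets are independent. -/
structure IsHomogeneousPPP {Ω : Type*} [MeasurableSpace Ω] (x : ℕ → Ω → Plane) (lam : ℝ)
    (P : Measure Ω) : Prop where
  measurable : ∀ j, Measurable (x j)
  count_law : ∀ B : Set Plane, MeasurableSet B → Bornology.IsBounded B →
    HasLaw (pointCount x B)
      ((poissonMeasure (lam * volume.real B).toNNReal).map (fun n : ℕ => (n : ℕ∞))) P
  count_indep : ∀ (n : ℕ) (B : Fin n → Set Plane), (∀ i, MeasurableSet (B i)) →
    (∀ i, Bornology.IsBounded (B i)) → Pairwise (fun i k => Disjoint (B i) (B k)) →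
    iIndepFun (fun i => pointCount x (B i)) P

/-- The channel matrix whose `j`-th column is the channel vector `h j`. -/
def channelMatrix {T U : ℕ} (h : Fin U → Fin T → ℂ) : Matrix (Fin T) (Fin U) ℂ :=
  Matrix.of fun t j => h j t

/-- The unnormalized zero-forcing precoder `H (Hᴴ H)⁻¹`. -/
def zfUnnormalized {T U : ℕ} (h : Fin U → Fin T → ℂ) : Matrix (Fin T) (Fin U) ℂ :=
  channelMatrix h * ((channelMatrix h)ᴴ * channelMatrix h)⁻¹

/-- The zero-forcing precoding vector of user `j`: the `j`-th column of `H (Hᴴ H)⁻¹`,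
normalized to unit Euclidean norm. -/
def zfVector {T U : ℕ} (h : Fin U → Fin T → ℂ) (j : Fin U) : Fin T → ℂ :=
  fun t => zfUnnormalized h t j /
    ((‖WithLp.toLp 2 (fun t' => zfUnnormalized h t' j)‖ : ℝ) : ℂ)

/-- The received signal gain `|h_jᴴ v_j|²` of user `j` under zero-forcing. -/
def zfGain {T U : ℕ} (h : Fin U → Fin T → ℂ) (j : Fin U) : ℝ :=
  ‖star (h j) ⬝ᵥ zfVector h j‖ ^ 2

/-- Interference power `∑_j P_d D_j^(-α_d) |e_j|²` (a sum in `[0, ∞]`) received at `z` from the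
transmitters located at `x j` with fading coefficients `e j`. -/
def d2dInterference (Pd αd : ℝ) (x : ℕ → Plane) (e : ℕ → ℂ) (z : Plane) : ℝ≥0∞ :=
  ∑' j, ENNReal.ofReal (Pd * dist z (x j) ^ (-αd) * ‖e j‖ ^ 2)

/-- The quantity `ζ = A_c P_c / U`. -/
def zetaPower (Ac Pc : ℝ) (U : ℕ) : ℝ := Ac * (Pc / U)

/-- The SINR of a cellular user with signal gain `g`, distance `D` to the base station and
interference `I`, namely `g / ((A_d / ζ) D^α_c (I + N₀ / A_d))`, with values in `[0, ∞]`. -/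
def cellularSINR (Ad ζ αc N₀ g D : ℝ) (I : ℝ≥0∞) : ℝ≥0∞ :=
  ENNReal.ofReal g /
    (ENNReal.ofReal (Ad / ζ * D ^ αc) * (I + ENNReal.ofReal (N₀ / Ad)))

/-- The normalized cardinal sine `sin (π z) / (π z)`. -/
def normalizedSinc (z : ℝ) : ℝ := Real.sin (Real.pi * z) / (Real.pi * z)

/-- The function `s ↦ exp (- (π λ / sinc (2/α)) (s P_d)^(2/α))`. -/
def interferenceExp (lam Pd αd s : ℝ) : ℝ :=
  Real.exp (-(Real.pi * lam / normalizedSinc (2 / αd)) * (s * Pd) ^ (2 / αd))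

/-- The conditional coverage probability given the distance to the base station, as a function
of `s`, with `M = T_c - U_c` and `c = N₀ / A_d`. -/
def coverageTerm (M : ℕ) (c lam Pd αd s : ℝ) : ℝ :=
  Real.exp (-(s * c)) *
    ∑ k ∈ Finset.range (M + 1), s ^ k / (k.factorial : ℝ) *
      ∑ i ∈ Finset.range (k + 1), (k.choose i : ℝ) * c ^ (k - i) *
        ((-1) ^ i * iteratedDeriv i (interferenceExp lam Pd αd) s)

end

/-! Zero forcing makes `v₀` a scalar multiple of the projection of `h₀` onto the orthogonal
complement of the other channels, so the gain is the squared norm of that projection. Given the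
other channels, which are a.s. linearly independent, the projection is a standard Gaussian vector in
dimension `T - U + 1`. The gain is thus a sum of `T - U + 1` unit exponentials (`zfGain_tail`), with
tail `e^(-y) ∑_{k ≤ T-U} y^k / k!` for `y ≥ 0`.

Given the user location, coverage means gain `≥ s (I + c)` with `I` the interference and `c = N₀ /
Ad`. Gain and interference are independent, so the conditional probability is the mean of the tail
at `s (I + c)`. The binomial theorem reduces it to the moments `E[I^i e^(-sI)]`, which are signed
derivatives of the Laplace transform of `I` (`integral_erlangTail_eq_coverageTerm`).

For that transform (`lintegral_expNeg_mul_d2dInterference`), averaging over the fading gives a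
factor `1 / (1 + w)`, `w = s Pd r^(-αd)`, for each transmitter at distance `r`. The Laplace
functional of the Poisson process turns the product into `exp (-λ ∫ w / (1 + w))`, and polar
coordinates with Euler's reflection formula evaluate the integral. Working in `[0, ∞]` avoids any
prior convergence question for `I`. -/

/-! ### Exponentials on `[0, ∞]` and the Poisson generating function. -/

/-- The function `t ↦ exp (-t)` on `[0, ∞]`, with `exp (-∞) = 0`. -/
noncomputable def expNeg (t : ℝ≥0∞) : ℝ≥0∞ := EReal.exp (-(t : EReal))

@[simp] lemma expNeg_zero : expNeg 0 = 1 := by simp [expNeg]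

@[simp] lemma expNeg_top : expNeg ∞ = 0 := by simp [expNeg]

lemma expNeg_antitone : Antitone expNeg := fun a b h => by
  simpa [expNeg] using h

lemma expNeg_le_one (t : ℝ≥0∞) : expNeg t ≤ 1 := by
  simpa using expNeg_antitone (zero_le : 0 ≤ t)

lemma expNeg_ne_top (t : ℝ≥0∞) : expNeg t ≠ ∞ :=
  ((expNeg_le_one t).trans_lt ENNReal.one_lt_top).ne

lemma continuous_expNeg : Continuous expNeg := by
  unfold expNeg
  exact ENNReal.continuous_exp.comp (continuous_neg.comp continuous_coe_ennreal_ereal)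

lemma measurable_expNeg : Measurable expNeg := continuous_expNeg.measurable

lemma expNeg_ofReal {x : ℝ} (hx : 0 ≤ x) :
    expNeg (ENNReal.ofReal x) = ENNReal.ofReal (Real.exp (-x)) := by
  rw [expNeg, EReal.coe_ennreal_ofReal, max_eq_left hx, ← EReal.coe_neg, EReal.exp_coe]

lemma expNeg_of_ne_top {t : ℝ≥0∞} (ht : t ≠ ∞) :
    expNeg t = ENNReal.ofReal (Real.exp (-t.toReal)) := by
  rw [← expNeg_ofReal ENNReal.toReal_nonneg, ENNReal.ofReal_toReal ht]

lemma expNeg_add (a b : ℝ≥0∞) : expNeg (a + b) = expNeg a * expNeg b := by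
  rcases eq_or_ne a ∞ with rfl | ha
  · simp
  rcases eq_or_ne b ∞ with rfl | hb
  · simp
  rw [expNeg_of_ne_top ha, expNeg_of_ne_top hb, expNeg_of_ne_top (by finiteness),
    ENNReal.toReal_add ha hb, ← ENNReal.ofReal_mul (by positivity), ← Real.exp_add]
  congr 2
  ring

lemma expNeg_sum {ι : Type*} (s : Finset ι) (f : ι → ℝ≥0∞) :
    expNeg (∑ i ∈ s, f i) = ∏ i ∈ s, expNeg (f i) := by
  classical
  induction s using Finset.induction_on with
  | empty => simp
  | insert a s ha ih => rw [Finset.sum_insert ha, Finset.prod_insert ha, expNeg_add, ih]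

lemma expNeg_natCast_mul (n : ℕ) (a : ℝ≥0∞) : expNeg (n * a) = expNeg a ^ n := by
  have := expNeg_sum (Finset.range n) (fun _ => a)
  simpa using this

lemma tendsto_expNeg_tsum (f : ℕ → ℝ≥0∞) :
    Filter.Tendsto (fun n => expNeg (∑ i ∈ Finset.range n, f i)) Filter.atTop
      (nhds (expNeg (∑' i, f i))) :=
  (continuous_expNeg.tendsto _).comp ENNReal.summable.hasSum.tendsto_sum_nat

/-- The probability generating function of the Poisson law. -/
lemma lintegral_expNeg_mul_poissonMeasure (r : NNReal) (a : ℝ≥0∞) :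
    ∫⁻ n : ℕ, expNeg (a * n) ∂(poissonMeasure r) = expNeg (r * (1 - expNeg a)) := by
  obtain ⟨q, hq0, hq1, hq⟩ : ∃ q : ℝ, 0 ≤ q ∧ q ≤ 1 ∧ expNeg a = ENNReal.ofReal q := by
    refine ⟨(expNeg a).toReal, ENNReal.toReal_nonneg, ?_, (ENNReal.ofReal_toReal
      (expNeg_ne_top a)).symm⟩
    simpa using ENNReal.toReal_mono ENNReal.one_ne_top (expNeg_le_one a)
  have h1 : (r : ℝ≥0∞) * (1 - expNeg a) = ENNReal.ofReal (r * (1 - q)) := by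
    rw [ENNReal.ofReal_mul r.coe_nonneg, ENNReal.ofReal_sub _ hq0, ENNReal.ofReal_one, hq,
      ENNReal.ofReal_coe_nnreal]
  rw [h1, expNeg_ofReal (mul_nonneg r.coe_nonneg (by linarith)), poissonMeasure, lintegral_sum_measure]
  have h2 : HasSum (fun n : ℕ => Real.exp (-r) * ((r * q) ^ n / n.factorial))
      (Real.exp (-r) * Real.exp (r * q)) := by
    rw [Real.exp_eq_exp_ℝ]
    exact (NormedSpace.expSeries_div_hasSum_exp ((r : ℝ) * q)).mul_left _
  have h3 : -((r : ℝ) * (1 - q)) = -r + r * q := by ring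
  rw [h3, Real.exp_add, ← h2.tsum_eq, ENNReal.ofReal_tsum_of_nonneg _ h2.summable]
  · refine tsum_congr fun n => ?_
    rw [lintegral_smul_measure, lintegral_dirac, mul_comm a, expNeg_natCast_mul, hq,
      ← ENNReal.ofReal_pow hq0, smul_eq_mul, ← ENNReal.ofReal_mul (by positivity)]
    congr 1
    rw [mul_pow]
    ring
  · intro n
    positivity

/-! ### The Laplace functional of a Poisson process. -/

lemma tsum_indicator_one_eq_pointCount {Ω : Type*} (x : ℕ → Ω → Plane) (B : Set Plane) (ω : Ω) :
    ∑' j, B.indicator (fun _ => (1 : ℝ≥0∞)) (x j ω) = ((pointCount x B ω : ℕ∞) : ℝ≥0∞) := by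
  rw [pointCount, ← ENNReal.tsum_set_one, tsum_subtype {j | x j ω ∈ B} (fun _ => (1 : ℝ≥0∞))]
  rfl

namespace IsHomogeneousPPP

variable {Ω : Type*} [MeasurableSpace Ω] {P : Measure Ω} {x : ℕ → Ω → Plane} {lam : ℝ}

lemma measurable_expNeg_mul_pointCount (hx : IsHomogeneousPPP x lam P) {B : Set Plane}
    (hB : MeasurableSet B) (a : ℝ≥0∞) :
    Measurable (fun ω => expNeg (a * ((pointCount x B ω : ℕ∞) : ℝ≥0∞))) := by
  simp_rw [← tsum_indicator_one_eq_pointCount]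
  refine measurable_expNeg.comp (Measurable.const_mul (Measurable.tsum fun j => ?_) a)
  exact (measurable_one.indicator hB).comp (hx.measurable j)

lemma lintegral_expNeg_mul_pointCount (hx : IsHomogeneousPPP x lam P) (hlam : 0 ≤ lam)
    {B : Set Plane} (hB : MeasurableSet B) (hB' : Bornology.IsBounded B) (a : ℝ≥0∞) :
    ∫⁻ ω, expNeg (a * ((pointCount x B ω : ℕ∞) : ℝ≥0∞)) ∂P =
      expNeg (ENNReal.ofReal lam * volume B * (1 - expNeg a)) := by
  have hmeas : Measurable (fun n : ℕ∞ => expNeg (a * (n : ℝ≥0∞))) := measurable_of_countable _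
  have h := (hx.count_law B hB hB').lintegral_comp (f := fun n : ℕ∞ => expNeg (a * (n : ℝ≥0∞)))
    hmeas.aemeasurable
  rw [h, lintegral_map hmeas (measurable_of_countable _)]
  have := lintegral_expNeg_mul_poissonMeasure (lam * volume.real B).toNNReal a
  simp only [ENat.toENNReal_coe]
  rw [this]
  congr 2
  have h4 : ((lam * volume.real B).toNNReal : ℝ≥0∞) = ENNReal.ofReal (lam * volume.real B) := rfl
  rw [h4, ENNReal.ofReal_mul hlam, measureReal_def, ENNReal.ofReal_toReal hB'.measure_lt_top.ne]

/-- The sum of `g` over the points is `∑ a * N(g = a)`. The level sets are disjoint and bounded, so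
the counts are independent Poisson variables and their generating functions multiply. The value `0`
is left out because its level set is unbounded. -/
lemma lintegral_expNeg_tsum_simpleFunc (hx : IsHomogeneousPPP x lam P) (hlam : 0 ≤ lam)
    (g : SimpleFunc Plane ℝ≥0∞) (hg : Bornology.IsBounded {y | g y ≠ 0}) :
    ∫⁻ ω, expNeg (∑' j, g (x j ω)) ∂P =
      expNeg (ENNReal.ofReal lam * ∫⁻ y, (1 - expNeg (g y))) := by
  classical
  set s : Finset ℝ≥0∞ := g.range.filter (· ≠ 0) with hs
  -- Used with `F = id` for the sum over points and with `F a = 1 - expNeg a` for the integral over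
  -- the plane.
  have hsum : ∀ (F : ℝ≥0∞ → ℝ≥0∞) (y : Plane), F 0 = 0 →
      F (g y) = ∑ a ∈ s, F a * (g ⁻¹' {a}).indicator (fun _ => 1) y := by
    intro F y hF
    by_cases h0 : g y = 0
    · rw [h0, hF, Finset.sum_eq_zero]
      intro a ha
      have : a ≠ 0 := (Finset.mem_filter.1 ha).2
      rw [Set.indicator_of_notMem, mul_zero]
      simp [h0, this.symm]
    · rw [Finset.sum_eq_single (g y)]
      · simp
      · intro b _ hb
        rw [Set.indicator_of_notMem, mul_zero]
        simpa using hb.symm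
      · intro h
        exact absurd (Finset.mem_filter.2 ⟨g.mem_range_self y, h0⟩) h
  have hbdd : ∀ a ∈ s, Bornology.IsBounded (g ⁻¹' {a}) := fun a ha => hg.subset fun y hy => by
    have : a ≠ 0 := (Finset.mem_filter.1 ha).2
    simp only [Set.mem_preimage, Set.mem_singleton_iff] at hy
    simpa [hy] using this
  have hmeas : ∀ a, MeasurableSet (g ⁻¹' {a}) := fun a => g.measurableSet_preimage _
  have hL : ∀ ω, expNeg (∑' j, g (x j ω)) =
      ∏ a ∈ s, expNeg (a * ((pointCount x (g ⁻¹' {a}) ω : ℕ∞) : ℝ≥0∞)) := by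
    intro ω
    rw [← expNeg_sum]
    congr 1
    simp_rw [← tsum_indicator_one_eq_pointCount, ← ENNReal.tsum_mul_left]
    rw [← Summable.tsum_finsetSum fun _ _ => ENNReal.summable]
    exact tsum_congr fun j => hsum id _ rfl
  have hind : iIndepFun (fun (a : s) ω => expNeg (a * ((pointCount x (g ⁻¹' {(a : ℝ≥0∞)}) ω : ℕ∞) :
      ℝ≥0∞))) P := by
    have h1 := hx.count_indep s.card (fun i => g ⁻¹' {((s.equivFin.symm i : s) : ℝ≥0∞)})
      (fun i => hmeas _) (fun i => hbdd _ (s.equivFin.symm i).2) (fun i k hik => by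
        refine Disjoint.preimage _ ?_
        rw [Set.disjoint_singleton]
        intro h
        exact hik (s.equivFin.symm.injective (Subtype.ext h)))
    have h2 := (h1.precomp s.equivFin.injective).comp
      (fun (a : s) (n : ℕ∞) => expNeg (a * (n : ℝ≥0∞))) (fun a => measurable_of_countable _)
    convert h2 using 3 with a
    simp
  simp_rw [hL]
  have h3 : ∀ ω, ∏ a ∈ s, expNeg (a * ((pointCount x (g ⁻¹' {a}) ω : ℕ∞) : ℝ≥0∞)) =
      ∏ a : s, expNeg (a * ((pointCount x (g ⁻¹' {(a : ℝ≥0∞)}) ω : ℕ∞) : ℝ≥0∞)) := fun ω =>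
    (Finset.prod_coe_sort s _).symm
  simp_rw [h3]
  rw [lintegral_prod_eq_prod_lintegral_of_indepFun Finset.univ _ hind
    (fun a => hx.measurable_expNeg_mul_pointCount (hmeas a) a)]
  rw [Finset.prod_congr rfl fun (a : s) _ =>
    hx.lintegral_expNeg_mul_pointCount hlam (hmeas a) (hbdd a a.2) a, ← expNeg_sum]
  congr 1
  have h4 : ∀ y, 1 - expNeg (g y) =
      ∑ a ∈ s, (1 - expNeg a) * (g ⁻¹' {a}).indicator (fun _ => 1) y := fun y =>
    hsum (fun a => 1 - expNeg a) y (by simp)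
  simp_rw [h4]
  rw [lintegral_finsetSum _ fun a _ => (measurable_const.indicator (hmeas a)).const_mul _,
    Finset.mul_sum, ← Finset.sum_coe_sort s]
  refine Finset.sum_congr rfl fun a _ => ?_
  rw [lintegral_const_mul _ (measurable_const.indicator (hmeas a)), lintegral_indicator (hmeas a)]
  simp only [lintegral_const, one_mul, Measure.restrict_apply_univ]
  ring

/-- The Laplace functional of a homogeneous Poisson point process. -/
theorem lintegral_expNeg_tsum (hx : IsHomogeneousPPP x lam P) [IsFiniteMeasure P] (hlam : 0 ≤ lam)
    {f : Plane → ℝ≥0∞} (hf : Measurable f) :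
    ∫⁻ ω, expNeg (∑' j, f (x j ω)) ∂P =
      expNeg (ENNReal.ofReal lam * ∫⁻ y, (1 - expNeg (f y))) := by
  -- The cut-off to growing balls makes the supports bounded, as the simple-function case requires.
  set g : ℕ → SimpleFunc Plane ℝ≥0∞ := fun n =>
    (SimpleFunc.eapprox f n).restrict (Metric.ball 0 n) with hg
  have hgval : ∀ n y, g n y =
      (Metric.ball (0 : Plane) n).indicator (SimpleFunc.eapprox f n) y := fun n y => by
    rw [hg, SimpleFunc.restrict_apply _ measurableSet_ball]
  have hmono : ∀ y, Monotone fun n => g n y := by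
    intro y m n hmn
    simp only [hgval]
    refine (Set.indicator_le_indicator (SimpleFunc.monotone_eapprox f hmn y)).trans ?_
    exact Set.indicator_le_indicator_of_subset (Metric.ball_subset_ball (by exact_mod_cast hmn))
      (fun _ => zero_le) y
  have hsup : ∀ y, Filter.Tendsto (fun n => g n y) Filter.atTop (nhds (f y)) := by
    intro y
    have h1 : Filter.Tendsto (fun n => SimpleFunc.eapprox f n y) Filter.atTop (nhds (f y)) := by
      rw [← SimpleFunc.iSup_eapprox_apply hf y]
      exact tendsto_atTop_iSup fun m n hmn => SimpleFunc.monotone_eapprox f hmn y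
    refine h1.congr' ?_
    obtain ⟨N, hN⟩ := exists_nat_gt ‖y‖
    filter_upwards [Filter.eventually_ge_atTop N] with n hn
    rw [hgval, Set.indicator_of_mem]
    simpa using hN.trans_le (by exact_mod_cast hn)
  have hbdd : ∀ n, Bornology.IsBounded {y | g n y ≠ 0} := fun n =>
    Metric.isBounded_ball.subset (fun y hy => by
      simp only [Set.mem_ofPred_eq, hgval] at hy
      exact Set.mem_of_indicator_ne_zero hy : _ ⊆ Metric.ball (0 : Plane) n)
  have hsums : ∀ ω, Filter.Tendsto (fun n => ∑' j, g n (x j ω)) Filter.atTop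
      (nhds (∑' j, f (x j ω))) := by
    intro ω
    have h1 : ∀ j, f (x j ω) = ⨆ n, g n (x j ω) := fun j =>
      tendsto_nhds_unique (hsup _) (tendsto_atTop_iSup (hmono _))
    -- Monotone convergence for the counting measure on the indices.
    have h2 : ∑' j, f (x j ω) = ⨆ n, ∑' j, g n (x j ω) := by
      simp_rw [h1, ← lintegral_count]
      rw [lintegral_iSup (fun n => measurable_of_countable _)]
      exact fun m n hmn j => hmono _ hmn
    rw [h2]
    exact tendsto_atTop_iSup fun m n hmn => ENNReal.tsum_le_tsum fun j => hmono _ hmn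
  have hleft : Filter.Tendsto (fun n => ∫⁻ ω, expNeg (∑' j, g n (x j ω)) ∂P) Filter.atTop
      (nhds (∫⁻ ω, expNeg (∑' j, f (x j ω)) ∂P)) := by
    refine tendsto_lintegral_of_dominated_convergence (fun _ => 1) (fun n => ?_)
      (fun n => Filter.Eventually.of_forall fun ω => expNeg_le_one _) (by simp)
      (Filter.Eventually.of_forall fun ω => (continuous_expNeg.tendsto _).comp (hsums ω))
    exact measurable_expNeg.comp (Measurable.tsum fun j =>
      (g n).measurable.comp (hx.measurable j))
  have hright : Filter.Tendsto (fun n => expNeg (ENNReal.ofReal lam * ∫⁻ y, (1 - expNeg (g n y))))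
      Filter.atTop (nhds (expNeg (ENNReal.ofReal lam * ∫⁻ y, (1 - expNeg (f y))))) := by
    refine (continuous_expNeg.tendsto _).comp (ENNReal.Tendsto.const_mul ?_
      (Or.inr ENNReal.ofReal_ne_top))
    -- Monotone rather than dominated convergence: the bound `1` is not integrable over the plane.
    refine lintegral_tendsto_of_tendsto_of_monotone (fun n => ?_)
      (Filter.Eventually.of_forall fun y m n hmn =>
        tsub_le_tsub_left (expNeg_antitone (hmono y hmn)) 1)
      (Filter.Eventually.of_forall fun y => ?_)
    · exact (measurable_const.sub (measurable_expNeg.comp (g n).measurable)).aemeasurable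
    · exact ENNReal.Tendsto.sub tendsto_const_nhds ((continuous_expNeg.tendsto _).comp (hsup y))
        (Or.inl ENNReal.one_ne_top)
  refine tendsto_nhds_unique hleft (hright.congr fun n => ?_)
  exact (hx.lintegral_expNeg_tsum_simpleFunc hlam (g n) (hbdd n)).symm

end IsHomogeneousPPP

/-! ### Gamma integrals and the intensity integral over the plane. -/

lemma lintegral_rpow_mul_exp_neg_mul_Ioi {a r : ℝ} (ha : 0 < a) (hr : 0 < r) :
    ∫⁻ t in Set.Ioi (0 : ℝ), ENNReal.ofReal (t ^ (a - 1) * Real.exp (-(r * t))) =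
      ENNReal.ofReal ((1 / r) ^ a * Real.Gamma a) := by
  have h := Real.integral_rpow_mul_exp_neg_mul_Ioi ha hr
  rw [← h, ofReal_integral_eq_lintegral_ofReal]
  -- A nonzero Bochner integral forces integrability, since the integral of a non-integrable
  -- function is `0`.
  · refine not_imp_comm.1 integral_undef ?_
    rw [h]
    have := Real.Gamma_pos_of_pos ha
    positivity
  · filter_upwards [ae_restrict_mem measurableSet_Ioi] with t ht
    have : (0 : ℝ) < t := ht
    positivity

lemma lintegral_exp_neg_mul_Ioi {r : ℝ} (hr : 0 < r) :
    ∫⁻ t in Set.Ioi (0 : ℝ), ENNReal.ofReal (Real.exp (-(r * t))) = ENNReal.ofReal (1 / r) := by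
  simpa using lintegral_rpow_mul_exp_neg_mul_Ioi one_pos hr

/-- Write `1 / (1 + v)` as `∫ e^(-(1+v)t) dt` and exchange the integrals. The result is `Γ(b) Γ(1 -
b)`, to which the reflection formula applies. -/
lemma integral_rpow_div_one_add {b : ℝ} (hb0 : 0 < b) (hb1 : b < 1) :
    ∫ v in Set.Ioi (0 : ℝ), v ^ (b - 1) / (1 + v) = Real.pi / Real.sin (Real.pi * b) := by
  have hG := Real.Gamma_pos_of_pos hb0
  have hG' := Real.Gamma_pos_of_pos (sub_pos.2 hb1)
  rw [integral_eq_lintegral_of_nonneg_ae]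
  rotate_left
  · filter_upwards [ae_restrict_mem measurableSet_Ioi] with t ht
    have : (0 : ℝ) < t := ht
    change (0 : ℝ) ≤ _
    positivity
  · exact (by fun_prop : Measurable fun v : ℝ => v ^ (b - 1) / (1 + v)).aestronglyMeasurable
  have h1 : ∀ v ∈ Set.Ioi (0 : ℝ), ENNReal.ofReal (v ^ (b - 1) / (1 + v)) =
      ∫⁻ t in Set.Ioi (0 : ℝ), ENNReal.ofReal (v ^ (b - 1) * Real.exp (-((1 + v) * t))) := by
    intro v hv
    have hv : (0 : ℝ) < v := hv
    simp_rw [ENNReal.ofReal_mul (Real.rpow_nonneg hv.le (b - 1))]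
    rw [lintegral_const_mul _ (by fun_prop), lintegral_exp_neg_mul_Ioi (by positivity),
      ← ENNReal.ofReal_mul (by positivity)]
    congr 1
    ring
  rw [setLIntegral_congr_fun measurableSet_Ioi h1, lintegral_lintegral_swap (by fun_prop)]
  have h2 : ∀ t ∈ Set.Ioi (0 : ℝ),
      ∫⁻ v in Set.Ioi (0 : ℝ), ENNReal.ofReal (v ^ (b - 1) * Real.exp (-((1 + v) * t))) =
      ENNReal.ofReal (Real.Gamma b) *
        ENNReal.ofReal (t ^ (1 - b - 1) * Real.exp (-(1 * t))) := by
    intro t ht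
    have ht : (0 : ℝ) < t := ht
    have h3 : ∀ v : ℝ, ENNReal.ofReal (v ^ (b - 1) * Real.exp (-((1 + v) * t))) =
        ENNReal.ofReal (Real.exp (-t)) * ENNReal.ofReal (v ^ (b - 1) * Real.exp (-(t * v))) := by
      intro v
      rw [← ENNReal.ofReal_mul (by positivity)]
      congr 1
      rw [show -((1 + v) * t) = -t + -(t * v) by ring, Real.exp_add]
      ring
    simp_rw [h3]
    rw [lintegral_const_mul _ (by fun_prop), lintegral_rpow_mul_exp_neg_mul_Ioi hb0 ht,
      ← ENNReal.ofReal_mul (by positivity), ← ENNReal.ofReal_mul hG.le]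
    congr 1
    rw [show 1 - b - 1 = -b by ring, Real.rpow_neg ht.le, one_div, Real.inv_rpow ht.le, one_mul]
    ring
  rw [setLIntegral_congr_fun measurableSet_Ioi h2, lintegral_const_mul _ (by fun_prop),
    lintegral_rpow_mul_exp_neg_mul_Ioi (sub_pos.2 hb1) one_pos, ← ENNReal.ofReal_mul hG.le,
    ENNReal.toReal_ofReal (by positivity), ← Real.Gamma_mul_Gamma_one_sub]
  simp

/-- The substitutions `u = r^(-α)` and `v = a u` lead to the previous integral with `b = 1 - 2/α`,
which lies in `(0, 1)` because `α > 2`. -/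
lemma integral_mul_div_one_add_rpow_neg {α a : ℝ} (hα : 2 < α) (ha : 0 < a) :
    ∫ r in Set.Ioi (0 : ℝ), r * (a * r ^ (-α) / (1 + a * r ^ (-α))) =
      a ^ (2 / α) * (Real.pi / Real.sin (Real.pi * (2 / α))) / α := by
  have hα0 : 0 < α := by linarith
  set g : ℝ → ℝ := fun u => u ^ (-(2 / α)) * (a / (1 + a * u)) / α with hg
  have h1 : ∀ r ∈ Set.Ioi (0 : ℝ), r * (a * r ^ (-α) / (1 + a * r ^ (-α))) =
      (|-α| * r ^ (-α - 1)) • g (r ^ (-α)) := by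
    intro r hr
    have hr : (0 : ℝ) < r := hr
    have h2 : (r ^ (-α)) ^ (-(2 / α)) = r ^ (2 : ℝ) := by
      rw [← Real.rpow_mul hr.le]
      congr 1
      field_simp
    have h3 : g (r ^ (-α)) = (r ^ (-α)) ^ (-(2 / α)) * (a / (1 + a * r ^ (-α))) / α := rfl
    rw [h3, abs_neg, abs_of_pos hα0, smul_eq_mul, h2, Real.rpow_sub_one hr.ne', Real.rpow_two]
    have : 0 < r ^ (-α) := by positivity
    field_simp
  rw [setIntegral_congr_fun measurableSet_Ioi h1,
    integral_comp_rpow_Ioi g (neg_ne_zero.2 hα0.ne')]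
  set k : ℝ → ℝ := fun v => v ^ ((1 - 2 / α) - 1) / (1 + v) with hk
  have h3 : ∀ u ∈ Set.Ioi (0 : ℝ), g u = (a ^ (2 / α) * a / α) * k (a * u) := by
    intro u hu
    have hu : (0 : ℝ) < u := hu
    rw [hg, hk]
    simp only
    rw [show 1 - 2 / α - 1 = -(2 / α) by ring, Real.mul_rpow ha.le hu.le, Real.rpow_neg ha.le]
    have : 0 < a ^ (2 / α) := by positivity
    field_simp
  rw [setIntegral_congr_fun measurableSet_Ioi h3, integral_const_mul,
    integral_comp_mul_left_Ioi k 0 ha, mul_zero, hk, integral_rpow_div_one_add]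
  · rw [show Real.pi * (1 - 2 / α) = Real.pi - Real.pi * (2 / α) by ring, Real.sin_pi_sub,
      smul_eq_mul]
    field_simp
  · rw [sub_pos, div_lt_one hα0]
    exact hα
  · have : 0 < 2 / α := by positivity
    linarith

lemma sin_pi_mul_two_div_pos {α : ℝ} (hα : 2 < α) : 0 < Real.sin (Real.pi * (2 / α)) := by
  have h : 2 / α < 1 := by rw [div_lt_one (by linarith)]; exact hα
  have h' : 0 < 2 / α := div_pos two_pos (by linarith)
  exact Real.sin_pos_of_pos_of_lt_pi (by positivity) (by nlinarith [Real.pi_pos])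

/-- The intensity integral of the interference field of the plane. -/
lemma lintegral_plane_div_one_add_rpow_neg {α a : ℝ} (hα : 2 < α) (ha : 0 < a) (z : Plane) :
    ∫⁻ y : Plane, ENNReal.ofReal (a * dist z y ^ (-α) / (1 + a * dist z y ^ (-α))) =
      ENNReal.ofReal (Real.pi / normalizedSinc (2 / α) * a ^ (2 / α)) := by
  have hsin := sin_pi_mul_two_div_pos hα
  have hα0 : 0 < α := by linarith
  set F : ℝ → ℝ := fun r => a * r ^ (-α) / (1 + a * r ^ (-α)) with hF
  have h1 : ∫ y : Plane, F ‖y‖ = Real.pi / normalizedSinc (2 / α) * a ^ (2 / α) := by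
    rw [integral_fun_norm_addHaar volume F]
    have h2 := integral_mul_div_one_add_rpow_neg hα ha
    simp only [finrank_euclideanSpace, Fintype.card_fin, Nat.add_one_sub_one, pow_one, smul_eq_mul,
      measureReal_def, EuclideanSpace.volume_ball_fin_two, nsmul_eq_mul]
    rw [hF, h2, normalizedSinc]
    simp only [Nat.cast_ofNat, ENNReal.ofReal_one, one_pow, one_mul, ENNReal.toReal_ofReal Real.pi_pos.le]
    field_simp
  have hpos : 0 < Real.pi / normalizedSinc (2 / α) * a ^ (2 / α) := by
    rw [normalizedSinc]
    positivity
  have hint : Integrable (fun y : Plane => F ‖y‖) := by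
    refine not_imp_comm.1 integral_undef ?_
    rw [h1]
    exact hpos.ne'
  rw [← h1, ofReal_integral_eq_lintegral_ofReal hint (Filter.Eventually.of_forall fun y => ?_)]
  · rw [← lintegral_sub_right_eq_self (fun y : Plane => ENNReal.ofReal (F ‖y‖)) z]
    refine lintegral_congr fun y => ?_
    rw [hF, dist_comm, dist_eq_norm]
  · change 0 ≤ F ‖y‖
    rw [hF]
    positivity

/-! ### Complex Gaussian variables and vectors. -/

instance : IsProbabilityMeasure complexGaussian := by
  rw [complexGaussian]
  exact Measure.isProbabilityMeasure_map (by fun_prop)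

instance (T : ℕ) : IsProbabilityMeasure (complexGaussianVec T) := by
  rw [complexGaussianVec]
  infer_instance

/-- The squared modulus of a standard complex Gaussian is exponential of rate `1`. -/
lemma lintegral_normSq_complexGaussian {f : ℝ → ℝ≥0∞} (hf : Measurable f) :
    ∫⁻ w, f (‖w‖ ^ 2) ∂complexGaussian =
      ∫⁻ t in Set.Ioi (0 : ℝ), ENNReal.ofReal (Real.exp (-t)) * f t := by
  have hv : (1 / 2 : NNReal) ≠ 0 := by norm_num
  have hpdf : ∀ x y : ℝ, gaussianPDF 0 (1 / 2) x * gaussianPDF 0 (1 / 2) y =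
      ENNReal.ofReal (Real.pi⁻¹ * Real.exp (-(x ^ 2 + y ^ 2))) := by
    intro x y
    rw [gaussianPDF, gaussianPDF, ← ENNReal.ofReal_mul (gaussianPDFReal_nonneg _ _ _),
      gaussianPDFReal, gaussianPDFReal]
    congr 1
    have h2 : (2 * Real.pi * ((1 / 2 : NNReal) : ℝ)) = Real.pi := by
      push_cast
      ring
    have h3 : (2 * ((1 / 2 : NNReal) : ℝ)) = 1 := by
      push_cast
      ring
    rw [h2, h3, mul_mul_mul_comm, ← Real.exp_add, ← mul_inv, Real.mul_self_sqrt Real.pi_pos.le]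
    congr 2
    ring
  rw [complexGaussian, lintegral_map (by fun_prop) (by fun_prop),
    gaussianReal_of_var_ne_zero _ hv, prod_withDensity (by fun_prop) (by fun_prop),
    lintegral_withDensity_eq_lintegral_mul _ (by fun_prop) (by fun_prop), ← Measure.volume_eq_prod,
    ← lintegral_comp_polarCoord_symm]
  have h1 : ∀ p ∈ polarCoord.target, ENNReal.ofReal p.1 •
      ((fun z : ℝ × ℝ => gaussianPDF 0 (1 / 2) z.1 * gaussianPDF 0 (1 / 2) z.2) *
        fun a : ℝ × ℝ => f (‖(a.1 : ℂ) + a.2 * Complex.I‖ ^ 2)) (polarCoord.symm p) =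
      ENNReal.ofReal (p.1 * (Real.pi⁻¹ * Real.exp (-p.1 ^ 2))) * f (p.1 ^ 2) := by
    intro p hp
    have hp0 : 0 < p.1 := by
      rw [polarCoord_target] at hp
      exact hp.1
    have hsq : (p.1 * Real.cos p.2) ^ 2 + (p.1 * Real.sin p.2) ^ 2 = p.1 ^ 2 := by
      rw [mul_pow, mul_pow, ← mul_add, Real.cos_sq_add_sin_sq, mul_one]
    rw [Pi.mul_apply, hpdf, Complex.sq_norm, Complex.normSq_add_mul_I, polarCoord_symm_apply]
    simp only [hsq]
    rw [smul_eq_mul, ← mul_assoc, ← ENNReal.ofReal_mul hp0.le]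
  rw [setLIntegral_congr_fun polarCoord.open_target.measurableSet h1, polarCoord_target,
    Measure.volume_eq_prod, ← Measure.prod_restrict]
  rw [lintegral_prod _ (by fun_prop)]
  simp only [lintegral_const, Measure.restrict_apply_univ, Real.volume_Ioo]
  have himg : (fun r : ℝ => r ^ 2) '' Set.Ioi 0 = Set.Ioi 0 := by
    ext t
    constructor
    · rintro ⟨r, hr, rfl⟩
      exact pow_pos (Set.mem_Ioi.1 hr) 2
    · intro ht
      exact ⟨√t, Real.sqrt_pos.2 ht, Real.sq_sqrt (le_of_lt ht)⟩
  -- The substitution `t = r²` acts on the exponential side. Its Jacobian `2r` matches the polar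
  -- side, where the angle contributes `2π` against the density constant `1/π`.
  conv_rhs => rw [← himg]
  rw [lintegral_image_eq_lintegral_abs_deriv_mul measurableSet_Ioi
    (f' := fun r => 2 * r) (fun r _ => by simpa using (hasDerivAt_pow 2 r).hasDerivWithinAt)
    (fun r hr s hs h => (pow_left_inj₀ (le_of_lt hr) (le_of_lt hs) two_ne_zero).1 h)]
  refine setLIntegral_congr_fun measurableSet_Ioi fun r hr => ?_
  have hr : (0 : ℝ) < r := hr
  rw [mul_right_comm, ← ENNReal.ofReal_mul (by positivity), ← mul_assoc (ENNReal.ofReal |2 * r|),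
    ← ENNReal.ofReal_mul (by positivity), abs_of_pos (by positivity)]
  congr 2
  have := Real.pi_pos
  field_simp
  ring

/-- The value `1 / (1 + w)` is kept in the form `expNeg (log (1 + w))` so that products over
transmitters become sums over points, the shape the Laplace functional accepts. -/
lemma lintegral_expNeg_normSq_complexGaussian {w : ℝ} (hw : 0 ≤ w) :
    ∫⁻ e, expNeg (ENNReal.ofReal (w * ‖e‖ ^ 2)) ∂complexGaussian =
      expNeg (ENNReal.ofReal (Real.log (1 + w))) := by
  rw [lintegral_normSq_complexGaussian (f := fun t => expNeg (ENNReal.ofReal (w * t)))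
    (measurable_expNeg.comp (by fun_prop))]
  have h1 : ∀ t ∈ Set.Ioi (0 : ℝ), ENNReal.ofReal (Real.exp (-t)) *
      expNeg (ENNReal.ofReal (w * t)) = ENNReal.ofReal (Real.exp (-((1 + w) * t))) := by
    intro t ht
    have ht : (0 : ℝ) < t := ht
    rw [expNeg_ofReal (by positivity), ← ENNReal.ofReal_mul (by positivity), ← Real.exp_add]
    congr 2
    ring
  rw [setLIntegral_congr_fun measurableSet_Ioi h1, lintegral_exp_neg_mul_Ioi (by linarith),
    expNeg_ofReal (Real.log_nonneg (by linarith)), Real.exp_neg, Real.exp_log (by linarith),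
    one_div]

lemma charFun_complexGaussian (t : ℂ) :
    charFun complexGaussian t = Complex.exp (-(‖t‖ ^ 2 : ℝ) / 4) := by
  rw [charFun_apply, complexGaussian, integral_map (by fun_prop) (by fun_prop)]
  have h1 : ∀ p : ℝ × ℝ, Complex.exp (inner ℝ ((p.1 : ℂ) + p.2 * Complex.I) t * Complex.I) =
      Complex.exp (t.re * p.1 * Complex.I) * Complex.exp (t.im * p.2 * Complex.I) := by
    intro p
    rw [← Complex.exp_add]
    congr 1
    rw [Complex.inner]
    simp
    ring
  simp_rw [h1]
  rw [integral_prod_mul (fun x : ℝ => Complex.exp (t.re * x * Complex.I))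
    (fun y : ℝ => Complex.exp (t.im * y * Complex.I)), ← charFun_apply_real, ← charFun_apply_real,
    charFun_gaussianReal, charFun_gaussianReal, ← Complex.exp_add, Complex.sq_norm,
    Complex.normSq_apply]
  congr 1
  push_cast
  ring

lemma charFun_complexGaussianVec {T : ℕ} (t : EuclideanSpace ℂ (Fin T)) :
    charFun ((complexGaussianVec T).map (WithLp.toLp 2)) t =
      Complex.exp (-(‖t‖ ^ 2 : ℝ) / 4) := by
  rw [complexGaussianVec, charFun_pi]
  simp_rw [charFun_complexGaussian]
  rw [← Complex.exp_sum, EuclideanSpace.norm_sq_eq, ← Finset.sum_div, Finset.sum_neg_distrib]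
  push_cast
  rfl

/-- The coordinates of a standard complex Gaussian vector along an orthonormal family are
independent standard complex Gaussians. -/
lemma map_inner_complexGaussianVec {T m : ℕ} {v : Fin m → EuclideanSpace ℂ (Fin T)}
    (hv : Orthonormal ℂ v) :
    (complexGaussianVec T).map (fun h j => inner ℂ (v j) (WithLp.toLp 2 h)) =
      complexGaussianVec m := by
  have hmeas : Measurable (fun (h : Fin T → ℂ) j => inner ℂ (v j) (WithLp.toLp 2 h)) := by
    fun_prop
  have : IsFiniteMeasure ((complexGaussianVec T).map
      (fun h j => inner ℂ (v j) (WithLp.toLp 2 h))) :=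
    Measure.isFiniteMeasure_map _ _
  refine charFun_eq_pi_iff.1 fun t => ?_
  have hcoord : ∏ i, charFun complexGaussian (t i) = Complex.exp (-(‖t‖ ^ 2 : ℝ) / 4) := by
    rw [← charFun_complexGaussianVec t, complexGaussianVec, charFun_pi]
  -- Pairing the coordinates with `t` is pairing `h` with `u`, and `‖u‖ = ‖t‖` by orthonormality.
  -- The characteristic function depends on the norm alone.
  set u : EuclideanSpace ℂ (Fin T) := ∑ j, t j • v j with hu
  have hnorm : ‖u‖ ^ 2 = ‖t‖ ^ 2 := by
    have h1 := hv.inner_sum (fun j => t j) (fun j => t j) Finset.univ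
    have h2 : ((‖u‖ ^ 2 : ℝ) : ℂ) = ((‖t‖ ^ 2 : ℝ) : ℂ) := by
      rw [EuclideanSpace.norm_sq_eq t]
      push_cast
      refine (inner_self_eq_norm_sq_to_K (𝕜 := ℂ) u).symm.trans ?_
      rw [hu, h1]
      exact Finset.sum_congr rfl fun j _ => Complex.conj_mul' _
    exact_mod_cast h2
  rw [hcoord, ← hnorm, ← charFun_complexGaussianVec u, charFun_apply, charFun_apply,
    Measure.map_map (by fun_prop) hmeas, integral_map (by fun_prop) (by fun_prop),
    integral_map (by fun_prop) (by fun_prop)]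
  refine integral_congr_ae (Filter.Eventually.of_forall fun h => ?_)
  have h3 : inner ℝ (WithLp.toLp 2 (fun j => inner ℂ (v j) (WithLp.toLp 2 h)) :
      PiLp 2 fun _ : Fin m => ℂ) t = inner ℝ (WithLp.toLp 2 h : PiLp 2 fun _ : Fin T => ℂ) u := by
    rw [PiLp.inner_apply, PiLp.inner_apply]
    have h4 : (inner ℂ (WithLp.toLp 2 h) u).re =
        ∑ i, inner ℝ ((WithLp.toLp 2 h : PiLp 2 fun _ : Fin T => ℂ) i) (u i) := by
      rw [PiLp.inner_apply, Complex.re_sum]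
      rfl
    rw [← h4, hu, inner_sum, Complex.re_sum]
    refine Finset.sum_congr rfl fun j _ => ?_
    rw [inner_smul_right, ← inner_conj_symm (WithLp.toLp 2 h) (v j), Complex.inner, mul_comm]
  simp only [Function.comp_apply]
  rw [h3]

/-! ### Erlang tails and squared norms of Gaussian vectors. -/

/-- The tail `P (S ≥ y)` of the sum `S` of `m` independent exponential variables of rate `1`. -/
noncomputable def erlangTail (m : ℕ) (y : ℝ) : ℝ :=
  if y ≤ 0 then 1 else Real.exp (-y) * ∑ k ∈ Finset.range m, y ^ k / (k.factorial : ℝ)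

lemma erlangTail_nonneg (m : ℕ) (y : ℝ) : 0 ≤ erlangTail m y := by
  unfold erlangTail
  split_ifs with h
  · exact zero_le_one
  · have := not_le.1 h
    positivity

@[fun_prop]
lemma measurable_erlangTail (m : ℕ) : Measurable (erlangTail m) :=
  Measurable.ite measurableSet_Iic measurable_const (by fun_prop)

/-- At `y = 0` the closed formula agrees with the value `1` only if there is at least one stage,
hence the index `m + 1`. -/
lemma erlangTail_of_nonneg (m : ℕ) {y : ℝ} (hy : 0 ≤ y) :
    erlangTail (m + 1) y =
      Real.exp (-y) * ∑ k ∈ Finset.range (m + 1), y ^ k / (k.factorial : ℝ) := by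
  rcases hy.eq_or_lt with rfl | hy
  · rw [erlangTail, if_pos le_rfl, Finset.sum_range_succ']
    simp
  · rw [erlangTail, if_neg (not_le.2 hy)]

/-- Condition on one exponential variable `t`. The range `t > y` contributes `e^(-y)`, the new term
of degree `0`; for `t < y` the exponentials combine to `e^(-y)` and integration raises each degree
by one. -/
lemma lintegral_exp_mul_erlangTail (m : ℕ) (y : ℝ) :
    ∫⁻ t in Set.Ioi (0 : ℝ), ENNReal.ofReal (Real.exp (-t)) * ENNReal.ofReal (erlangTail m (y - t)) =
      ENNReal.ofReal (erlangTail (m + 1) y) := by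
  have htail : ∀ a : ℝ, ∫⁻ t in Set.Ioi a, ENNReal.ofReal (Real.exp (-t)) =
      ENNReal.ofReal (Real.exp (-a)) := by
    intro a
    rw [← integral_exp_neg_Ioi a, ofReal_integral_eq_lintegral_ofReal]
    · exact integrableOn_exp_neg_Ioi a
    · exact Filter.Eventually.of_forall fun t => (Real.exp_pos _).le
  have hone : ∀ t, y ≤ t →
      ENNReal.ofReal (Real.exp (-t)) * ENNReal.ofReal (erlangTail m (y - t)) =
        ENNReal.ofReal (Real.exp (-t)) := by
    intro t ht
    rw [erlangTail, if_pos (by linarith), ENNReal.ofReal_one, mul_one]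
  rcases le_or_gt y 0 with hy | hy
  · rw [setLIntegral_congr_fun measurableSet_Ioi
      (fun t (ht : 0 < t) => hone t (hy.trans ht.le)), htail, erlangTail, if_pos hy]
    simp
  rw [← Set.Ioc_union_Ioi_eq_Ioi hy.le, lintegral_union measurableSet_Ioi
    (Set.Ioc_disjoint_Ioi le_rfl), setLIntegral_congr_fun measurableSet_Ioi
      (fun t (ht : y < t) => hone t ht.le), htail]
  -- The endpoint `t = y` is excluded: there the tail is `1`, while the sum is empty when `m = 0`.
  have hleft : ∀ t ∈ Set.Ioo 0 y,
      ENNReal.ofReal (Real.exp (-t)) * ENNReal.ofReal (erlangTail m (y - t)) =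
      ENNReal.ofReal (Real.exp (-y) * ∑ k ∈ Finset.range m, (y - t) ^ k / (k.factorial : ℝ)) := by
    intro t ht
    rw [erlangTail, if_neg (by linarith [ht.2]), ← ENNReal.ofReal_mul (Real.exp_pos _).le,
      ← mul_assoc, ← Real.exp_add]
    congr 3
    ring
  have hval : ∫ t in (0 : ℝ)..y, Real.exp (-y) *
      ∑ k ∈ Finset.range m, (y - t) ^ k / (k.factorial : ℝ) =
      Real.exp (-y) * ∑ k ∈ Finset.range m, y ^ (k + 1) / ((k + 1).factorial : ℝ) := by
    rw [intervalIntegral.integral_const_mul,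
      intervalIntegral.integral_comp_sub_left
        (fun u => ∑ k ∈ Finset.range m, u ^ k / (k.factorial : ℝ)) y,
      intervalIntegral.integral_finsetSum
        fun k _ => (by fun_prop : Continuous _).intervalIntegrable _ _]
    congr 1
    refine Finset.sum_congr rfl fun k _ => ?_
    rw [intervalIntegral.integral_div, integral_pow, Nat.factorial_succ]
    push_cast
    field_simp
    simp
  have hnonneg : ∀ t ∈ Set.Ioc 0 y,
      0 ≤ Real.exp (-y) * ∑ k ∈ Finset.range m, (y - t) ^ k / (k.factorial : ℝ) := by
    intro t ht
    have : 0 ≤ y - t := by linarith [ht.2]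
    positivity
  rw [setLIntegral_congr Ioo_ae_eq_Ioc.symm, setLIntegral_congr_fun measurableSet_Ioo hleft,
    setLIntegral_congr Ioo_ae_eq_Ioc, ← ofReal_integral_eq_lintegral_ofReal,
    ← intervalIntegral.integral_of_le hy.le, hval, ← ENNReal.ofReal_add (by positivity)
      (by positivity), erlangTail, if_neg (not_le.2 hy), Finset.sum_range_succ']
  · congr 1
    simp
    ring
  · exact ((by fun_prop : Continuous _).intervalIntegrable 0 y).1
  · filter_upwards [ae_restrict_mem measurableSet_Ioc] with t ht using hnonneg t ht

/-- The squared norm of a standard complex Gaussian vector has an Erlang law. -/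
lemma complexGaussianVec_tail (m : ℕ) (y : ℝ) :
    complexGaussianVec m {g | y ≤ ∑ i, ‖g i‖ ^ 2} = ENNReal.ofReal (erlangTail m y) := by
  induction m generalizing y with
  | zero =>
    rcases le_or_gt y 0 with hy | hy
    · simp [erlangTail, hy]
    · simp [erlangTail, not_le.2 hy]
  | succ m ih =>
    have hset : MeasurableSet {p : ℂ × (Fin m → ℂ) | y ≤ ‖p.1‖ ^ 2 + ∑ i, ‖p.2 i‖ ^ 2} :=
      measurableSet_le (by fun_prop) (by fun_prop)
    have hmp := measurePreserving_piFinSuccAbove (fun _ : Fin (m + 1) => complexGaussian) 0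
    have h1 := hmp.measure_preimage hset.nullMeasurableSet
    have h2 : (MeasurableEquiv.piFinSuccAbove (fun _ : Fin (m + 1) => ℂ) 0) ⁻¹'
        {p : ℂ × (Fin m → ℂ) | y ≤ ‖p.1‖ ^ 2 + ∑ i, ‖p.2 i‖ ^ 2} =
        {g | y ≤ ∑ i, ‖g i‖ ^ 2} := by
      ext g
      simp [Fin.sum_univ_succ, Fin.tail]
    rw [h2] at h1
    rw [complexGaussianVec, h1, Measure.prod_apply hset]
    have h3 : ∀ w : ℂ, (Measure.pi fun _ : Fin m => complexGaussian)
        (Prod.mk w ⁻¹' {p : ℂ × (Fin m → ℂ) | y ≤ ‖p.1‖ ^ 2 + ∑ i, ‖p.2 i‖ ^ 2}) =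
        ENNReal.ofReal (erlangTail m (y - ‖w‖ ^ 2)) := by
      intro w
      rw [← ih, complexGaussianVec]
      congr 1
      ext g
      simp [add_comm]
    simp_rw [h3]
    rw [lintegral_normSq_complexGaussian (f := fun t => ENNReal.ofReal (erlangTail m (y - t)))
      (by fun_prop), lintegral_exp_mul_erlangTail]

lemma complexGaussianVec_tail_of_orthonormal {T m : ℕ} {v : Fin m → EuclideanSpace ℂ (Fin T)}
    (hv : Orthonormal ℂ v) (y : ℝ) :
    complexGaussianVec T {h | y ≤ ∑ j, ‖inner ℂ (v j) (WithLp.toLp 2 h)‖ ^ 2} =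
      ENNReal.ofReal (erlangTail m y) := by
  rw [← complexGaussianVec_tail m y, ← map_inner_complexGaussianVec hv,
    Measure.map_apply (by fun_prop) (measurableSet_le (by fun_prop) (by fun_prop))]
  rfl

/-! ### Almost sure linear independence and measurability of the gain. -/

lemma complexGaussian_singleton_zero : complexGaussian {0} = 0 := by
  have h1 : complexGaussian {0} =
      ∫⁻ w, (Set.indicator {0} 1 : ℝ → ℝ≥0∞) (‖w‖ ^ 2) ∂complexGaussian := by
    rw [← lintegral_indicator_one (measurableSet_singleton (0 : ℂ))]
    refine lintegral_congr fun w => ?_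
    by_cases hw : w = 0 <;> simp [hw]
  rw [h1, lintegral_normSq_complexGaussian (measurable_one.indicator (measurableSet_singleton 0)),
    setLIntegral_congr_fun (g := fun _ => 0) measurableSet_Ioi]
  · simp
  · intro t ht
    have : t ≠ 0 := ne_of_gt ht
    simp [this]

/-- A proper subspace has a unit normal vector. The coordinate of `h` along it is `CN(0,1)`, which
has no atom at `0`. -/
lemma complexGaussianVec_ae_notMem {T : ℕ} (W : Submodule ℂ (Fin T → ℂ)) (hW : W ≠ ⊤) :
    ∀ᵐ h ∂complexGaussianVec T, h ∉ W := by
  set L := (WithLp.linearEquiv 2 ℂ (Fin T → ℂ)).symm with hL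
  set W' : Submodule ℂ (EuclideanSpace ℂ (Fin T)) := W.map L.toLinearMap with hW'
  have hne : W'ᗮ ≠ ⊥ := by
    rw [Ne, Submodule.orthogonal_eq_bot_iff]
    intro h
    refine hW (eq_top_iff.2 fun x _ => ?_)
    have hx : L x ∈ W' := h ▸ Submodule.mem_top
    obtain ⟨y, hy, hxy⟩ := hx
    exact L.injective hxy ▸ hy
  obtain ⟨v, hv, hv0⟩ := Submodule.exists_mem_ne_zero_of_ne_bot hne
  set e : Fin 1 → EuclideanSpace ℂ (Fin T) := fun _ => ((‖v‖ : ℂ)⁻¹) • v with he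
  have hon : Orthonormal ℂ e := by
    refine ⟨fun i => ?_, fun i j hij => absurd (Subsingleton.elim i j) hij⟩
    simp [he, norm_smul, hv0]
  have h1 : ∀ᵐ g ∂complexGaussianVec 1, g 0 ≠ 0 := by
    have := (measurePreserving_eval (fun _ : Fin 1 => complexGaussian) 0).measure_preimage
      (measurableSet_singleton (0 : ℂ)).nullMeasurableSet
    rw [complexGaussian_singleton_zero] at this
    rw [ae_iff, ← this, complexGaussianVec]
    congr 1
    ext g
    simp
  rw [← map_inner_complexGaussianVec hon] at h1
  have h2 := ae_of_ae_map (by fun_prop) h1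
  filter_upwards [h2] with h hh hmem
  refine hh ?_
  have h3 : inner ℂ v (WithLp.toLp 2 h) = 0 := by
    have h4 : inner ℂ (WithLp.toLp 2 h) v = 0 :=
      (Submodule.mem_orthogonal _ _).1 hv _ ⟨h, hmem, rfl⟩
    rw [← inner_conj_symm, h4, map_zero]
  simp only [he]
  rw [inner_smul_left, h3, mul_zero]

lemma linearIndependent_iff_gram_det_ne_zero {T U : ℕ} (h : Fin U → Fin T → ℂ) :
    LinearIndependent ℂ h ↔ ((channelMatrix h)ᴴ * channelMatrix h).det ≠ 0 := by
  have hinj : LinearIndependent ℂ h ↔ Function.Injective (channelMatrix h).mulVec :=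
    (Matrix.mulVec_injective_iff (M := channelMatrix h)).symm
  rw [hinj, ← isUnit_iff_ne_zero, ← Matrix.isUnit_iff_isUnit_det]
  refine ⟨fun hinj => ?_, fun hu => ?_⟩
  · open scoped ComplexOrder in
    exact (Matrix.PosDef.conjTranspose_mul_self _ hinj).isUnit
  · intro x y hxy
    refine Matrix.mulVec_injective_iff_isUnit.2 hu ?_
    rw [← Matrix.mulVec_mulVec, ← Matrix.mulVec_mulVec, hxy]

lemma continuous_gram {T U : ℕ} :
    Continuous fun h : Fin U → Fin T → ℂ => (channelMatrix h)ᴴ * channelMatrix h := by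
  have h1 : Continuous fun h : Fin U → Fin T → ℂ => channelMatrix h :=
    continuous_matrix fun t j => by
      simp only [channelMatrix, Matrix.of_apply]
      fun_prop
  exact h1.matrix_conjTranspose.matrix_mul h1

lemma measurableSet_linearIndependent (T U : ℕ) :
    MeasurableSet {h : Fin U → Fin T → ℂ | LinearIndependent ℂ h} := by
  simp_rw [linearIndependent_iff_gram_det_ne_zero]
  exact (continuous_gram.matrix_det.measurable (measurableSet_singleton 0)).compl

lemma measurable_zfUnnormalized {T U : ℕ} (t : Fin T) (j : Fin U) :
    Measurable fun h : Fin U → Fin T → ℂ => zfUnnormalized h t j := by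
  simp only [zfUnnormalized, Matrix.mul_apply, Matrix.inv_def, Ring.inverse_eq_inv',
    Matrix.smul_apply, smul_eq_mul]
  -- The inverse appears as the inverse determinant times the adjugate, a formula also valid for
  -- singular matrices, so measurability holds everywhere.
  refine Finset.measurable_sum _ fun i _ => Measurable.mul ?_ (Measurable.mul ?_ ?_)
  · simp only [channelMatrix, Matrix.of_apply]
    fun_prop
  · exact continuous_gram.matrix_det.measurable.inv
  · exact (continuous_gram.matrix_adjugate.matrix_elem i j).measurable

lemma measurable_zfGain {T U : ℕ} (j : Fin U) :
    Measurable fun h : Fin U → Fin T → ℂ => zfGain h j := by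
  simp only [zfGain, zfVector, dotProduct, EuclideanSpace.norm_eq, Pi.star_apply]
  have := fun t => measurable_zfUnnormalized (T := T) t j
  fun_prop

/-- Add one vector at a time: the span of fewer than `T` vectors is proper, so an independent
Gaussian vector a.s. avoids it. -/
lemma ae_linearIndependent {T : ℕ} (n : ℕ) (hn : n ≤ T) :
    ∀ᵐ h ∂(Measure.pi fun _ : Fin n => complexGaussianVec T), LinearIndependent ℂ h := by
  induction n with
  | zero => exact Filter.Eventually.of_forall fun h => linearIndependent_empty_type
  | succ n ih =>
    have hmp := measurePreserving_piFinSuccAbove (fun _ : Fin (n + 1) => complexGaussianVec T) 0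
    have h1 : ∀ᵐ p ∂((complexGaussianVec T).prod (Measure.pi fun _ : Fin n => complexGaussianVec T)),
        LinearIndependent ℂ (Fin.cons p.1 p.2 : Fin (n + 1) → Fin T → ℂ) := by
      have hset : MeasurableSet {p : (Fin T → ℂ) × (Fin n → Fin T → ℂ) |
          LinearIndependent ℂ (Fin.cons p.1 p.2 : Fin (n + 1) → Fin T → ℂ)} := by
        have := (MeasurableEquiv.piFinSuccAbove (fun _ : Fin (n + 1) => Fin T → ℂ) 0).symm.measurable
          (measurableSet_linearIndependent T (n + 1))
        convert this using 1
        ext p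
        simp only [MeasurableEquiv.piFinSuccAbove, Fin.insertNthEquiv_zero]
        rfl
      rw [ae_iff, ← Set.compl_ofPred, Measure.prod_apply_symm hset.compl]
      refine (lintegral_congr_ae ?_).trans lintegral_zero
      filter_upwards [ih (by omega)] with r hr
      have hspan : Submodule.span ℂ (Set.range r) ≠ ⊤ := by
        intro htop
        have := finrank_span_eq_card hr
        rw [htop, finrank_top] at this
        simp at this
        omega
      refine measure_mono_null ?_ (ae_iff.1 (complexGaussianVec_ae_notMem _ hspan))
      intro x hx
      simp only [Set.mem_preimage, Set.mem_compl_iff, Set.mem_ofPred_eq,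
        linearIndependent_finCons, not_and, not_not] at hx ⊢
      exact hx hr
    have h2 := hmp.quasiMeasurePreserving.ae h1
    filter_upwards [h2] with h hh
    convert hh using 1
    simp [MeasurableEquiv.piFinSuccAbove, Fin.cons_self_tail]

/-! ### The law of the zero-forcing gain. -/

/-- The zero-forcing gain is the squared norm of the projection of the channel onto the
orthogonal complement of the other channels. -/
lemma zfGain_eq_sum {T n m : ℕ} {h : Fin (n + 1) → Fin T → ℂ} (hli : LinearIndependent ℂ h)
    {W : Submodule ℂ (EuclideanSpace ℂ (Fin T))}
    (hW : W = Submodule.span ℂ (Set.range fun j : Fin n => WithLp.toLp 2 (h j.succ)))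
    (b : OrthonormalBasis (Fin m) ℂ Wᗮ) :
    zfGain h 0 = ∑ j, ‖inner ℂ (b j : EuclideanSpace ℂ (Fin T)) (WithLp.toLp 2 (h 0))‖ ^ 2 ∧
      0 < zfGain h 0 := by
  set H : Fin (n + 1) → EuclideanSpace ℂ (Fin T) := fun j => WithLp.toLp 2 (h j) with hH
  set u : EuclideanSpace ℂ (Fin T) := WithLp.toLp 2 (fun t => zfUnnormalized h t 0) with hu
  set c : Fin (n + 1) → ℂ := fun j => ((channelMatrix h)ᴴ * channelMatrix h)⁻¹ j 0 with hc
  -- The columns of the precoder are dual to the channels: `u` is orthogonal to every other channel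
  -- and has inner product `1` with `h 0`.
  have hdual : (channelMatrix h)ᴴ * zfUnnormalized h = 1 := by
    rw [zfUnnormalized, ← Matrix.mul_assoc, Matrix.mul_nonsing_inv]
    exact isUnit_iff_ne_zero.2 ((linearIndependent_iff_gram_det_ne_zero h).1 hli)
  have hinner : ∀ j, inner ℂ (H j) u = if j = 0 then 1 else 0 := by
    intro j
    have := congrFun (congrFun hdual j) 0
    rw [Matrix.one_apply] at this
    rw [← this, hH, hu, EuclideanSpace.inner_toLp_toLp, dotProduct_comm]
    rfl
  have hcomb : u = ∑ j, c j • H j := by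
    ext t
    simp only [hu, hH, hc, WithLp.ofLp_sum, WithLp.ofLp_smul, Finset.sum_apply, Pi.smul_apply,
      smul_eq_mul, zfUnnormalized, Matrix.mul_apply (M := channelMatrix h)]
    exact Finset.sum_congr rfl fun j _ => mul_comm _ _
  have huW : u ∈ Wᗮ := by
    rw [Submodule.mem_orthogonal]
    intro w hw
    rw [hW] at hw
    induction hw using Submodule.span_induction with
    | mem x hx =>
      obtain ⟨j, rfl⟩ := hx
      simpa using hinner j.succ
    | zero => simp
    | add x y _ _ hx hy => rw [inner_add_left, hx, hy, add_zero]
    | smul a x _ hx => rw [inner_smul_left, hx, mul_zero]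
  set p : Wᗮ := Wᗮ.orthogonalProjectionOnto (H 0) with hp
  -- Projecting `u = ∑ c j • H j` onto `Wᗮ` fixes `u` and kills every term except `j = 0`.
  have hup : (⟨u, huW⟩ : Wᗮ) = c 0 • p := by
    refine ext_inner_left ℂ fun w => ?_
    rw [inner_smul_right, hp, Submodule.inner_orthogonalProjectionOnto_eq_of_mem_left]
    change inner ℂ (w : EuclideanSpace ℂ (Fin T)) u = _
    rw [hcomb, inner_sum, Fin.sum_univ_succ, Finset.sum_eq_zero, add_zero,
      inner_smul_right]
    intro j _
    rw [inner_smul_right, ← inner_conj_symm,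
      (Submodule.mem_orthogonal _ _).1 w.2 _ (hW ▸ Submodule.subset_span ⟨j, rfl⟩), map_zero, mul_zero]
  have hone : ‖c 0‖ * ‖p‖ ^ 2 = 1 := by
    have h1 : inner ℂ (⟨u, huW⟩ : Wᗮ) p = 1 := by
      rw [hp, Submodule.inner_orthogonalProjectionOnto_eq_of_mem_left, ← inner_conj_symm]
      change (starRingEnd ℂ) (inner ℂ (H 0) u) = 1
      rw [hinner]
      simp
    rw [hup, inner_smul_left, inner_self_eq_norm_sq_to_K] at h1
    have := congrArg norm h1
    simpa using this
  have hnorm : ‖u‖ = ‖c 0‖ * ‖p‖ := by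
    rw [← norm_smul, ← hup]
    rfl
  have hp0 : 0 < ‖p‖ := by
    rcases (norm_nonneg p).eq_or_lt with h0 | h0
    · rw [← h0] at hone
      simp at hone
    · exact h0
  have hgain : zfGain h 0 = ‖p‖ ^ 2 := by
    have h1 : star (h 0) ⬝ᵥ zfVector h 0 = inner ℂ (H 0) u / ((‖u‖ : ℝ) : ℂ) := by
      rw [hH, hu, EuclideanSpace.inner_toLp_toLp, dotProduct_comm _ (star (h 0))]
      simp only [dotProduct, zfVector, Finset.sum_div]
      exact Finset.sum_congr rfl fun t _ => (mul_div_assoc _ _ _).symm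
    rw [zfGain, h1, hinner, if_pos rfl, norm_div, norm_one, Complex.norm_real, norm_norm, hnorm]
    have hc0 : ‖c 0‖ = 1 / ‖p‖ ^ 2 := by
      field_simp
      exact hone
    rw [hc0]
    field_simp
  rw [hgain]
  refine ⟨?_, by positivity⟩
  rw [← b.sum_sq_norm_inner_right p]
  refine Finset.sum_congr rfl fun j _ => ?_
  rw [hp, Submodule.inner_orthogonalProjectionOnto_eq_of_mem_left]

/-- The zero-forcing gain is a.s. positive and has the Erlang law with `T - U + 1` stages. -/
lemma zfGain_tail {T n : ℕ} (hn : n + 1 ≤ T) (y : ℝ) :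
    (Measure.pi fun _ : Fin (n + 1) => complexGaussianVec T) {h | y ≤ zfGain h 0} =
      ENNReal.ofReal (erlangTail (T - n) y) := by
  have hmp := measurePreserving_piFinSuccAbove (fun _ : Fin (n + 1) => complexGaussianVec T) 0
  set e := MeasurableEquiv.piFinSuccAbove (fun _ : Fin (n + 1) => Fin T → ℂ) 0
  have hset : MeasurableSet {h : Fin (n + 1) → Fin T → ℂ | y ≤ zfGain h 0} :=
    measurableSet_le measurable_const (measurable_zfGain 0)
  -- Fix the other channels `r` and integrate over the channel of user `0`; the inner probability is
  -- a.s. the same for all `r`.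
  rw [← hmp.symm.measure_preimage hset.nullMeasurableSet,
    Measure.prod_apply_symm (e.symm.measurable hset)]
  rw [lintegral_congr_ae (g := fun _ => ENNReal.ofReal (erlangTail (T - n) y)), lintegral_const,
    measure_univ, mul_one]
  filter_upwards [ae_linearIndependent n (by omega)] with r hr
  have hspan : Submodule.span ℂ (Set.range r) ≠ ⊤ := by
    intro htop
    have := finrank_span_eq_card hr
    rw [htop, finrank_top] at this
    simp at this
    omega
  set W := Submodule.span ℂ (Set.range fun j : Fin n =>
    (WithLp.toLp 2 (r j) : EuclideanSpace ℂ (Fin T))) with hW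
  -- With `U = n + 1` users this dimension is `T - U + 1`, the number of Erlang stages.
  have hrank : Module.finrank ℂ Wᗮ = T - n := by
    have hli : LinearIndependent ℂ fun j : Fin n =>
        (WithLp.toLp 2 (r j) : EuclideanSpace ℂ (Fin T)) :=
      hr.map' (WithLp.linearEquiv 2 ℂ (Fin T → ℂ)).symm.toLinearMap (LinearEquiv.ker _)
    have h1 : Module.finrank ℂ W = n := by
      simpa using finrank_span_eq_card hli
    have h2 := W.finrank_add_finrank_orthogonal
    rw [h1, finrank_euclideanSpace_fin] at h2
    omega
  set b : OrthonormalBasis (Fin (T - n)) ℂ Wᗮ :=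
    (stdOrthonormalBasis ℂ Wᗮ).reindex (finCongr hrank)
  have hon : Orthonormal ℂ fun j => (b j : EuclideanSpace ℂ (Fin T)) :=
    b.orthonormal.comp_linearIsometry Wᗮ.subtypeₗᵢ
  rw [← complexGaussianVec_tail_of_orthonormal hon y]
  refine measure_congr ?_
  filter_upwards [complexGaussianVec_ae_notMem _ hspan] with x hx
  have hli : LinearIndependent ℂ (Fin.cons x r : Fin (n + 1) → Fin T → ℂ) :=
    linearIndependent_finCons.2 ⟨hr, hx⟩
  have h1 := (zfGain_eq_sum hli hW b).1
  have h2 : e.symm (x, r) = Fin.cons x r := by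
    simp only [e, MeasurableEquiv.piFinSuccAbove, Fin.insertNthEquiv_zero]
    rfl
  refine propext ?_
  change y ≤ zfGain (e.symm (x, r)) 0 ↔ y ≤ _
  rw [h2, h1]
  rfl

lemma ae_zfGain_pos {T n : ℕ} (hn : n + 1 ≤ T) :
    ∀ᵐ h ∂(Measure.pi fun _ : Fin (n + 1) => complexGaussianVec T), 0 < zfGain h 0 := by
  filter_upwards [ae_linearIndependent (n + 1) hn] with h hh
  exact (zfGain_eq_sum hh rfl (stdOrthonormalBasis ℂ _)).2

/-! ### Conditioning on independent variables. -/

section Independence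

variable {Ω α β : Type*} [MeasurableSpace Ω] [MeasurableSpace α] [MeasurableSpace β]
  {P : Measure Ω} [IsProbabilityMeasure P] {X : Ω → α} {Y : Ω → β}

lemma lintegral_prodMk_of_indepFun (hX : Measurable X) (hY : Measurable Y) (h : IndepFun X Y P)
    {f : α × β → ℝ≥0∞} (hf : Measurable f) :
    ∫⁻ ω, f (X ω, Y ω) ∂P = ∫⁻ ω, ∫⁻ ω', f (X ω, Y ω') ∂P ∂P := by
  rw [← lintegral_map hf (hX.prodMk hY),
    (indepFun_iff_map_prod_eq_prod_map_map hX.aemeasurable hY.aemeasurable).1 h,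
    lintegral_prod _ hf.aemeasurable, lintegral_map hf.lintegral_prod_right' hX]
  exact lintegral_congr fun ω => lintegral_map (by fun_prop) hY

lemma measure_prodMk_of_indepFun (hX : Measurable X) (hY : Measurable Y) (h : IndepFun X Y P)
    {S : Set (α × β)} (hS : MeasurableSet S) :
    P {ω | (X ω, Y ω) ∈ S} = ∫⁻ ω, P {ω' | (X ω, Y ω') ∈ S} ∂P := by
  have h1 := lintegral_prodMk_of_indepFun hX hY h (measurable_one.indicator hS)
  have h2 : ∀ Z : Ω → α × β, Measurable Z →
      ∫⁻ ω, (S.indicator 1 (Z ω) : ℝ≥0∞) ∂P = P {ω | Z ω ∈ S} := by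
    intro Z hZ
    have h3 : MeasurableSet {ω | Z ω ∈ S} := hZ hS
    rw [← lintegral_indicator_one h3]
    rfl
  rw [h2 _ (hX.prodMk hY)] at h1
  rw [h1]
  exact lintegral_congr fun ω => h2 _ (measurable_const.prodMk hY)

/-- Freeze `X`, then `Z`: by independence `Y` keeps its law, so the conditional probability is its
tail at the frozen threshold. In the application these are the positions, the fading and the
channels. -/
lemma measure_le_of_indepFun {γ : Type*} [MeasurableSpace γ] {Z : Ω → γ} (hX : Measurable X)
    (hY : Measurable Y) (hZ : Measurable Z) (hXYZ : IndepFun X (fun ω => (Y ω, Z ω)) P)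
    (hYZ : IndepFun Y Z P) {J : α × γ → ℝ} (hJ : Measurable J) {g : β → ℝ} (hg : Measurable g)
    {F : ℝ → ℝ≥0∞} (hF : Measurable F) (htail : ∀ y, P {ω | y ≤ g (Y ω)} = F y) :
    P {ω | J (X ω, Z ω) ≤ g (Y ω)} = ∫⁻ ω, F (J (X ω, Z ω)) ∂P := by
  have hXZ : IndepFun X Z P := hXYZ.comp measurable_id measurable_snd
  have hS : MeasurableSet {q : α × β × γ | J (q.1, q.2.2) ≤ g q.2.1} :=
    measurableSet_le (by fun_prop) (by fun_prop)
  have hS' : ∀ a : α, MeasurableSet {q : γ × β | J (a, q.1) ≤ g q.2} := fun a =>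
    measurableSet_le (by fun_prop) (by fun_prop)
  refine (measure_prodMk_of_indepFun hX (hY.prodMk hZ) hXYZ hS).trans ?_
  rw [lintegral_prodMk_of_indepFun hX hZ hXZ (f := fun q => F (J q)) (hF.comp hJ)]
  refine lintegral_congr fun ω => ?_
  refine (measure_prodMk_of_indepFun hZ hY hYZ.symm (hS' (X ω))).trans ?_
  exact lintegral_congr fun ω' => htail (J (X ω, Z ω'))

end Independence

/-! ### The Laplace transform and finiteness of the interference. -/

section Interference

variable {Ω : Type*} [MeasurableSpace Ω] {P : Measure Ω} [IsProbabilityMeasure P]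

/-- This is the average over the fading at frozen positions. Independence settles finite sums;
continuity of `expNeg` and the bound `1` give the limit. -/
lemma lintegral_expNeg_tsum_mul_normSq {e : ℕ → Ω → ℂ} (he : ∀ j, Measurable (e j))
    (he_law : ∀ j, HasLaw (e j) complexGaussian P) (he_indep : iIndepFun e P)
    {w : ℕ → ℝ} (hw : ∀ j, 0 ≤ w j) :
    ∫⁻ ω, expNeg (∑' j, ENNReal.ofReal (w j * ‖e j ω‖ ^ 2)) ∂P =
      expNeg (∑' j, ENNReal.ofReal (Real.log (1 + w j))) := by
  have hmeas : ∀ j, Measurable fun v : ℂ => expNeg (ENNReal.ofReal (w j * ‖v‖ ^ 2)) := fun j =>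
    measurable_expNeg.comp (by fun_prop)
  have hfin : ∀ n, ∫⁻ ω, expNeg (∑ j ∈ Finset.range n, ENNReal.ofReal (w j * ‖e j ω‖ ^ 2)) ∂P =
      expNeg (∑ j ∈ Finset.range n, ENNReal.ofReal (Real.log (1 + w j))) := by
    intro n
    simp_rw [expNeg_sum]
    rw [lintegral_prod_eq_prod_lintegral_of_indepFun (Finset.range n)
      (fun j ω => expNeg (ENNReal.ofReal (w j * ‖e j ω‖ ^ 2))) (he_indep.comp _ hmeas)
      (fun j => (hmeas j).comp (he j))]
    refine Finset.prod_congr rfl fun j _ => ?_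
    rw [← lintegral_expNeg_normSq_complexGaussian (hw j)]
    exact (he_law j).lintegral_comp (hmeas j).aemeasurable
  refine tendsto_nhds_unique ?_ (tendsto_expNeg_tsum fun j => ENNReal.ofReal (Real.log (1 + w j)))
  simp_rw [← hfin]
  refine tendsto_lintegral_of_dominated_convergence (fun _ => 1) (fun n => ?_)
    (fun n => Filter.Eventually.of_forall fun ω => expNeg_le_one _) (by simp)
    (Filter.Eventually.of_forall fun ω => tendsto_expNeg_tsum _)
  exact measurable_expNeg.comp (Finset.measurable_sum _ fun j _ => by
    have := he j
    fun_prop)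

lemma measurable_d2dInterference {γ : Type*} [MeasurableSpace γ] (Pd αd : ℝ) {X : γ → ℕ → Plane}
    {E : γ → ℕ → ℂ} {z : γ → Plane} (hX : Measurable X) (hE : Measurable E) (hz : Measurable z) :
    Measurable fun a => d2dInterference Pd αd (X a) (E a) (z a) := by
  unfold d2dInterference
  exact Measurable.tsum fun j => by fun_prop

/-- The Laplace transform of the interference. -/
lemma lintegral_expNeg_mul_d2dInterference {x : ℕ → Ω → Plane} {e : ℕ → Ω → ℂ} {lam Pd αd s : ℝ}
    (hx : IsHomogeneousPPP x lam P) (he : ∀ j, Measurable (e j))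
    (he_law : ∀ j, HasLaw (e j) complexGaussian P) (he_indep : iIndepFun e P)
    (hxe : IndepFun (fun ω j => x j ω) (fun ω j => e j ω) P)
    (hlam : 0 ≤ lam) (hPd : 0 < Pd) (hαd : 2 < αd) (hs : 0 < s) (z : Plane) :
    ∫⁻ ω, expNeg (ENNReal.ofReal s *
        d2dInterference Pd αd (fun j => x j ω) (fun j => e j ω) z) ∂P =
      ENNReal.ofReal (interferenceExp lam Pd αd s) := by
  have ha : 0 < s * Pd := mul_pos hs hPd
  have hw : ∀ y : Plane, 0 ≤ s * Pd * dist z y ^ (-αd) := fun y => by positivity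
  have hI := lintegral_prodMk_of_indepFun (measurable_pi_lambda _ hx.measurable)
    (measurable_pi_lambda _ he) hxe (f := fun q => expNeg (ENNReal.ofReal s *
      d2dInterference Pd αd q.1 q.2 z)) (measurable_expNeg.comp (Measurable.const_mul
        (measurable_d2dInterference Pd αd measurable_fst measurable_snd measurable_const) _))
  rw [hI]
  have h1 : ∀ ω, ∫⁻ ω', expNeg (ENNReal.ofReal s *
      d2dInterference Pd αd (fun j => x j ω) (fun j => e j ω') z) ∂P =
      expNeg (∑' j, ENNReal.ofReal (Real.log (1 + s * Pd * dist z (x j ω) ^ (-αd)))) := by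
    intro ω
    rw [← lintegral_expNeg_tsum_mul_normSq he he_law he_indep fun j => hw (x j ω)]
    refine lintegral_congr fun ω' => ?_
    rw [d2dInterference, ← ENNReal.tsum_mul_left]
    congr 1
    refine tsum_congr fun j => ?_
    rw [← ENNReal.ofReal_mul hs.le]
    congr 1
    ring
  simp_rw [h1]
  rw [hx.lintegral_expNeg_tsum hlam
    (f := fun y => ENNReal.ofReal (Real.log (1 + s * Pd * dist z y ^ (-αd)))) (by fun_prop)]
  -- This is `1 - 1 / (1 + w) = w / (1 + w)`.
  have h2 : ∀ y : Plane, 1 - expNeg (ENNReal.ofReal (Real.log (1 + s * Pd * dist z y ^ (-αd)))) =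
      ENNReal.ofReal (s * Pd * dist z y ^ (-αd) / (1 + s * Pd * dist z y ^ (-αd))) := by
    intro y
    have := hw y
    rw [expNeg_ofReal (Real.log_nonneg (by linarith)), Real.exp_neg, Real.exp_log (by linarith),
      ← ENNReal.ofReal_one, ← ENNReal.ofReal_sub _ (by positivity)]
    congr 1
    field_simp
    ring
  have hsin := sin_pi_mul_two_div_pos hαd
  have hsinc : 0 < normalizedSinc (2 / αd) := by
    have : 0 < αd := by linarith
    rw [normalizedSinc]
    positivity
  simp_rw [h2]
  rw [lintegral_plane_div_one_add_rpow_neg hαd ha, ← ENNReal.ofReal_mul hlam,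
    expNeg_ofReal (by positivity), interferenceExp]
  congr 2
  ring

/-- Since `e^(-sI)` vanishes where `I = ∞`, its mean is at most `P (I ≠ ∞)`. The explicit transform
tends to `1` as `s → 0+`. -/
lemma ae_d2dInterference_ne_top {x : ℕ → Ω → Plane} {e : ℕ → Ω → ℂ} {lam Pd αd : ℝ}
    (hx : IsHomogeneousPPP x lam P) (he : ∀ j, Measurable (e j))
    (he_law : ∀ j, HasLaw (e j) complexGaussian P) (he_indep : iIndepFun e P)
    (hxe : IndepFun (fun ω j => x j ω) (fun ω j => e j ω) P)
    (hlam : 0 ≤ lam) (hPd : 0 < Pd) (hαd : 2 < αd) (z : Plane) :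
    ∀ᵐ ω ∂P, d2dInterference Pd αd (fun j => x j ω) (fun j => e j ω) z ≠ ∞ := by
  set I := fun ω => d2dInterference Pd αd (fun j => x j ω) (fun j => e j ω) z with hI
  have hmeas : Measurable I := measurable_d2dInterference Pd αd
    (measurable_pi_lambda _ hx.measurable) (measurable_pi_lambda _ he) measurable_const
  have hset : MeasurableSet {ω | I ω ≠ ∞} := (hmeas (measurableSet_singleton ∞)).compl
  have hle : ∀ s : ℝ, 0 < s → ENNReal.ofReal (interferenceExp lam Pd αd s) ≤ P {ω | I ω ≠ ∞} := by
    intro s hs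
    rw [← lintegral_expNeg_mul_d2dInterference hx he he_law he_indep hxe hlam hPd hαd hs z,
      ← lintegral_indicator_one hset]
    refine lintegral_mono fun ω => ?_
    by_cases hω : I ω = ∞
    · have : d2dInterference Pd αd (fun j => x j ω) (fun j => e j ω) z = ∞ := hω
      simp [this, ENNReal.mul_top, hs]
    · rw [Set.indicator_of_mem (by exact hω)]
      exact expNeg_le_one _
  have hcont : Continuous (interferenceExp lam Pd αd) := by
    unfold interferenceExp
    have : 0 ≤ 2 / αd := div_nonneg two_pos.le (by linarith)
    have h1 : Continuous fun s : ℝ => (s * Pd) ^ (2 / αd) :=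
      (Real.continuous_rpow_const this).comp (by fun_prop)
    fun_prop
  have hzero : interferenceExp lam Pd αd 0 = 1 := by
    have : 2 / αd ≠ 0 := (div_pos two_pos (by linarith)).ne'
    rw [interferenceExp, zero_mul, Real.zero_rpow this]
    simp
  have hlim : Filter.Tendsto (fun s => ENNReal.ofReal (interferenceExp lam Pd αd s))
      (nhdsWithin 0 (Set.Ioi 0)) (nhds 1) := by
    rw [← ENNReal.ofReal_one, ← hzero]
    exact ((ENNReal.continuous_ofReal.comp hcont).tendsto 0).mono_left nhdsWithin_le_nhds
  have hone : 1 ≤ P {ω | I ω ≠ ∞} := le_of_tendsto hlim (by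
    filter_upwards [self_mem_nhdsWithin] with s hs using hle s hs)
  exact (mem_ae_iff_prob_eq_one hset).2 (le_antisymm prob_le_one hone)

lemma integral_exp_neg_mul_d2dInterference {x : ℕ → Ω → Plane} {e : ℕ → Ω → ℂ}
    {lam Pd αd s : ℝ} (hx : IsHomogeneousPPP x lam P) (he : ∀ j, Measurable (e j))
    (he_law : ∀ j, HasLaw (e j) complexGaussian P) (he_indep : iIndepFun e P)
    (hxe : IndepFun (fun ω j => x j ω) (fun ω j => e j ω) P)
    (hlam : 0 ≤ lam) (hPd : 0 < Pd) (hαd : 2 < αd) (hs : 0 < s) (z : Plane) :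
    ∫ ω, Real.exp (-(s *
        (d2dInterference Pd αd (fun j => x j ω) (fun j => e j ω) z).toReal)) ∂P =
      interferenceExp lam Pd αd s := by
  have hlap := lintegral_expNeg_mul_d2dInterference hx he he_law he_indep hxe hlam hPd hαd hs z
  have hfin := ae_d2dInterference_ne_top hx he he_law he_indep hxe hlam hPd hαd z
  have hm : Measurable fun ω => d2dInterference Pd αd (fun j => x j ω) (fun j => e j ω) z :=
    measurable_d2dInterference Pd αd (measurable_pi_lambda _ hx.measurable)
      (measurable_pi_lambda _ he) measurable_const
  have hmeas : AEStronglyMeasurable (fun ω => Real.exp (-(s *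
      (d2dInterference Pd αd (fun j => x j ω) (fun j => e j ω) z).toReal))) P :=
    (Real.measurable_exp.comp (hm.ennreal_toReal.const_mul s).neg).aestronglyMeasurable
  rw [integral_eq_lintegral_of_nonneg_ae
    (Filter.Eventually.of_forall fun ω => (Real.exp_pos _).le) hmeas,
    ← ENNReal.toReal_ofReal (show 0 ≤ interferenceExp lam Pd αd s from (Real.exp_pos _).le),
    ← hlap]
  congr 1
  refine lintegral_congr_ae ?_
  filter_upwards [hfin] with ω hω
  rw [expNeg_of_ne_top (ENNReal.mul_ne_top ENNReal.ofReal_ne_top hω), ENNReal.toReal_mul,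
    ENNReal.toReal_ofReal hs.le]

end Interference

/-! ### Coverage at a fixed location. -/

section Coverage

variable {Ω : Type*} [MeasurableSpace Ω] {P : Measure Ω} [IsProbabilityMeasure P]

/-- Derivatives of a Laplace transform are moments of the tilted law. -/
lemma integral_pow_mul_exp_neg {X : Ω → ℝ} (hX : Measurable X) (hX0 : ∀ ω, 0 ≤ X ω) {φ : ℝ → ℝ}
    (hφ : ∀ s, 0 < s → ∫ ω, Real.exp (-(s * X ω)) ∂P = φ s) (i : ℕ) {s : ℝ} (hs : 0 < s) :
    Integrable (fun ω => X ω ^ i * Real.exp (-(s * X ω))) P ∧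
      ∫ ω, X ω ^ i * Real.exp (-(s * X ω)) ∂P = (-1) ^ i * iteratedDeriv i φ s := by
  -- As `X ≥ 0`, `e^(-tX) ≤ 1` for `t > 0`. So `s` is interior to the domain of the moment
  -- generating function of `-X`, which may be differentiated there.
  have hsub : Set.Ioi (0 : ℝ) ⊆ integrableExpSet (fun ω => -X ω) P := by
    intro t ht
    have ht : 0 < t := ht
    refine Integrable.of_bound (C := 1) (by fun_prop) (Filter.Eventually.of_forall fun ω => ?_)
    rw [Real.norm_of_nonneg (Real.exp_pos _).le, Real.exp_le_one_iff]
    nlinarith [mul_nonneg ht.le (hX0 ω)]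
  have hmem : s ∈ interior (integrableExpSet (fun ω => -X ω) P) :=
    interior_maximal hsub isOpen_Ioi hs
  have hsign : ∀ ω, X ω ^ i * Real.exp (-(s * X ω)) =
      (-1) ^ i * ((-X ω) ^ i * Real.exp (s * -X ω)) := by
    intro ω
    rw [← mul_assoc, ← mul_pow, mul_neg]
    simp
  have hloc : φ =ᶠ[nhds s] mgf (fun ω => -X ω) P := by
    filter_upwards [isOpen_Ioi.mem_nhds hs] with t ht
    rw [← hφ t ht, mgf]
    simp
  simp_rw [hsign]
  refine ⟨(integrable_pow_mul_exp_of_mem_interior_integrableExpSet hmem i).const_mul _, ?_⟩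
  rw [integral_const_mul, hloc.iteratedDeriv_eq, iteratedDeriv_mgf hmem]

lemma integral_erlangTail_eq_coverageTerm {X : Ω → ℝ} (hX : Measurable X) (hX0 : ∀ ω, 0 ≤ X ω)
    {lam Pd αd : ℝ}
    (hφ : ∀ s, 0 < s → ∫ ω, Real.exp (-(s * X ω)) ∂P = interferenceExp lam Pd αd s)
    (M : ℕ) {c s : ℝ} (hc : 0 ≤ c) (hs : 0 < s) :
    Integrable (fun ω => erlangTail (M + 1) (s * (X ω + c))) P ∧
      ∫ ω, erlangTail (M + 1) (s * (X ω + c)) ∂P = coverageTerm M c lam Pd αd s := by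
  have hexp : ∀ ω, erlangTail (M + 1) (s * (X ω + c)) =
      Real.exp (-(s * c)) * ∑ k ∈ Finset.range (M + 1), s ^ k / (k.factorial : ℝ) *
        ∑ i ∈ Finset.range (k + 1), (k.choose i : ℝ) * c ^ (k - i) *
          (X ω ^ i * Real.exp (-(s * X ω))) := by
    intro ω
    rw [erlangTail_of_nonneg M (mul_nonneg hs.le (add_nonneg (hX0 ω) hc)),
      show -(s * (X ω + c)) = -(s * c) + -(s * X ω) by ring, Real.exp_add, mul_assoc,
      Finset.mul_sum]
    congr 1
    refine Finset.sum_congr rfl fun k _ => ?_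
    rw [mul_pow, add_pow, Finset.mul_sum, Finset.mul_sum, Finset.sum_div, Finset.mul_sum]
    refine Finset.sum_congr rfl fun i _ => ?_
    ring
  have hint := fun i => (integral_pow_mul_exp_neg hX hX0 hφ i hs).1
  have hval := fun i => (integral_pow_mul_exp_neg hX hX0 hφ i hs).2
  have hint' : ∀ k, Integrable (fun ω => s ^ k / (k.factorial : ℝ) *
      ∑ i ∈ Finset.range (k + 1), (k.choose i : ℝ) * c ^ (k - i) *
        (X ω ^ i * Real.exp (-(s * X ω)))) P := fun k =>
    (integrable_finsetSum _ fun i _ => (hint i).const_mul _).const_mul _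
  simp_rw [hexp]
  refine ⟨(integrable_finsetSum _ fun k _ => hint' k).const_mul _, ?_⟩
  rw [integral_const_mul, integral_finsetSum _ fun k _ => hint' k, coverageTerm]
  congr 1
  refine Finset.sum_congr rfl fun k _ => ?_
  rw [integral_const_mul, integral_finsetSum _ fun i _ => (hint i).const_mul _]
  congr 1
  refine Finset.sum_congr rfl fun i _ => ?_
  rw [integral_const_mul, hval]

/-- The factor `s^k` kills every term with `k ≥ 1`, whatever value `iteratedDeriv` takes at `0`. -/
lemma coverageTerm_zero (M : ℕ) (c lam Pd : ℝ) {αd : ℝ} (hαd : 0 < αd) :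
    coverageTerm M c lam Pd αd 0 = 1 := by
  rw [coverageTerm, Finset.sum_range_succ', Finset.sum_eq_zero]
  · have : 2 / αd ≠ 0 := (div_pos two_pos hαd).ne'
    simp [interferenceExp, Real.zero_rpow this]
  · intro k _
    simp

/-- Positivity of `g` allows clearing the denominator even when it is `0`, where the ratio is `∞`;
finiteness of `I` brings the inequality back to the reals. -/
lemma ofReal_le_cellularSINR_iff {Ad ζ αc N₀ g D β : ℝ} {I : ℝ≥0∞} (hAd : 0 < Ad) (hζ : 0 < ζ)
    (hN₀ : 0 ≤ N₀) (hβ : 0 ≤ β) (hD : 0 ≤ D) (hg : 0 < g) (hI : I ≠ ∞) :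
    ENNReal.ofReal β ≤ cellularSINR Ad ζ αc N₀ g D I ↔
      β / ζ * Ad * D ^ αc * (I.toReal + N₀ / Ad) ≤ g := by
  have hc : 0 ≤ N₀ / Ad := by positivity
  have hκ : 0 ≤ Ad / ζ * D ^ αc := by positivity
  have h1 : I + ENNReal.ofReal (N₀ / Ad) = ENNReal.ofReal (I.toReal + N₀ / Ad) := by
    rw [ENNReal.ofReal_add ENNReal.toReal_nonneg hc, ENNReal.ofReal_toReal hI]
  rw [cellularSINR, h1, ← ENNReal.ofReal_mul hκ, ENNReal.le_div_iff_mul_le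
    (Or.inr (ENNReal.ofReal_pos.2 hg).ne') (Or.inr ENNReal.ofReal_ne_top),
    ← ENNReal.ofReal_mul hβ, ENNReal.ofReal_le_ofReal_iff hg.le]
  rw [show β * (Ad / ζ * D ^ αc * (I.toReal + N₀ / Ad)) =
    β / ζ * Ad * D ^ αc * (I.toReal + N₀ / Ad) by ring]

lemma map_channels_eq_pi {T U : ℕ} {h : Fin U → Ω → Fin T → ℂ} (hh : ∀ j, Measurable (h j))
    (hh_law : ∀ j, HasLaw (h j) (complexGaussianVec T) P) (hh_indep : iIndepFun h P) :
    P.map (fun ω j => h j ω) = Measure.pi fun _ => complexGaussianVec T := by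
  rw [(iIndepFun_iff_map_fun_eq_pi_map fun j => (hh j).aemeasurable).1 hh_indep]
  congr 1
  exact funext fun j => (hh_law j).map_eq

/-- The coverage probability given the location of the user. -/
lemma measure_le_cellularSINR {T n : ℕ} (hn : n + 1 ≤ T) {lam Pd Ad ζ αc αd N₀ β : ℝ}
    (hlam : 0 < lam) (hPd : 0 < Pd) (hζ : 0 < ζ) (hAd : 0 < Ad)
    (hαd : 2 < αd) (hN₀ : 0 ≤ N₀) (hβ : 0 < β) {x : ℕ → Ω → Plane}
    (hx : IsHomogeneousPPP x lam P) {h : Fin (n + 1) → Ω → Fin T → ℂ} (hh : ∀ j, Measurable (h j))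
    (hh_law : ∀ j, HasLaw (h j) (complexGaussianVec T) P) (hh_indep : iIndepFun h P)
    {e : ℕ → Ω → ℂ} (he : ∀ j, Measurable (e j))
    (he_law : ∀ j, HasLaw (e j) complexGaussian P) (he_indep : iIndepFun e P)
    (hx_indep : IndepFun (fun ω j => x j ω) (fun ω => ((fun j => h j ω), (fun j => e j ω))) P)
    (hhe_indep : IndepFun (fun ω j => h j ω) (fun ω j => e j ω) P)
    {z : Plane} (hz : z ≠ 0) :
    0 ≤ coverageTerm (T - (n + 1)) (N₀ / Ad) lam Pd αd (β / ζ * Ad * dist z 0 ^ αc) ∧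
    P {ω | ENNReal.ofReal β ≤ cellularSINR Ad ζ αc N₀ (zfGain (fun j => h j ω) 0) (dist z 0)
        (d2dInterference Pd αd (fun j => x j ω) (fun j => e j ω) z)} =
      ENNReal.ofReal (coverageTerm (T - (n + 1)) (N₀ / Ad) lam Pd αd
        (β / ζ * Ad * dist z 0 ^ αc)) := by
  set D := dist z 0
  set s := β / ζ * Ad * D ^ αc with hs
  set c := N₀ / Ad with hc
  set I := fun ω => d2dInterference Pd αd (fun j => x j ω) (fun j => e j ω) z with hI
  have hD : 0 < D := dist_pos.2 hz
  have hs0 : 0 < s := by positivity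
  have hc0 : 0 ≤ c := by positivity
  have hXm : Measurable fun ω j => x j ω := measurable_pi_lambda _ hx.measurable
  have hHm : Measurable fun ω j => h j ω := measurable_pi_lambda _ hh
  have hEm : Measurable fun ω j => e j ω := measurable_pi_lambda _ he
  have hxe : IndepFun (fun ω j => x j ω) (fun ω j => e j ω) P :=
    hx_indep.comp measurable_id measurable_snd
  have hIm : Measurable I := measurable_d2dInterference Pd αd hXm hEm measurable_const
  have hfin : ∀ᵐ ω ∂P, I ω ≠ ∞ :=
    ae_d2dInterference_ne_top hx he he_law he_indep hxe hlam.le hPd hαd z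
  have hHlaw := map_channels_eq_pi hh hh_law hh_indep
  have hgpos : ∀ᵐ ω ∂P, 0 < zfGain (fun j => h j ω) 0 :=
    ae_of_ae_map hHm.aemeasurable (hHlaw ▸ ae_zfGain_pos hn)
  have htail : ∀ y, P {ω | y ≤ zfGain (fun j => h j ω) 0} =
      ENNReal.ofReal (erlangTail (T - (n + 1) + 1) y) := by
    intro y
    rw [show T - (n + 1) + 1 = T - n by omega, ← zfGain_tail hn y, ← hHlaw,
      Measure.map_apply hHm (measurableSet_le measurable_const (measurable_zfGain 0))]
    rfl
  obtain ⟨hint, hval⟩ := integral_erlangTail_eq_coverageTerm (P := P) hIm.ennreal_toReal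
    (fun ω => ENNReal.toReal_nonneg) (fun t ht => integral_exp_neg_mul_d2dInterference hx he he_law
      he_indep hxe hlam.le hPd hαd ht z) (T - (n + 1)) hc0 hs0
  refine ⟨hval ▸ integral_nonneg fun ω => erlangTail_nonneg _ _, ?_⟩
  have hevent : P {ω | ENNReal.ofReal β ≤ cellularSINR Ad ζ αc N₀ (zfGain (fun j => h j ω) 0) D
      (I ω)} = P {ω | s * ((I ω).toReal + c) ≤ zfGain (fun j => h j ω) 0} := by
    refine measure_congr ?_
    filter_upwards [hgpos, hfin] with ω hg hω
    exact propext (ofReal_le_cellularSINR_iff hAd hζ hN₀ hβ.le hD.le hg hω)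
  rw [hevent, ← hval, ofReal_integral_eq_lintegral_ofReal hint
    (Filter.Eventually.of_forall fun ω => erlangTail_nonneg _ _)]
  exact measure_le_of_indepFun hXm hHm hEm hx_indep hhe_indep
    (J := fun q => s * ((d2dInterference Pd αd q.1 q.2 z).toReal + c))
    (((measurable_d2dInterference Pd αd measurable_fst measurable_snd
      measurable_const).ennreal_toReal.add_const c).const_mul s)
    (measurable_zfGain 0) (measurable_erlangTail _).ennreal_ofReal htail

end Coverage

/-! ### Averaging over the user location. -/

theorem proposition2 {Ω : Type*} [MeasurableSpace Ω] (P : Measure Ω) [IsProbabilityMeasure P]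
    (T U : ℕ) (hU : 1 ≤ U) (hUT : U ≤ T)
    (R lam Pc Pd Ac Ad αc αd N₀ β : ℝ)
    (hR : 0 < R) (hlam : 0 < lam) (hPc : 0 < Pc) (hPd : 0 < Pd) (hAc : 0 < Ac) (hAd : 0 < Ad)
    (hαc : 0 < αc) (hαd : 2 < αd) (hN₀ : 0 ≤ N₀) (hβ : 0 ≤ β)
    -- location of the typical cellular user, uniform in the disc of radius `R`
    (z : Ω → Plane) (hz : Measurable z)
    (hz_law : HasLaw z (volume[|Metric.closedBall (0 : Plane) R]) P)
    -- locations of the D2D transmitters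
    (x : ℕ → Ω → Plane) (hx : IsHomogeneousPPP x lam P)
    -- channels from the base station to the cellular users: independent, Rayleigh fading
    (h : Fin U → Ω → Fin T → ℂ) (hh : ∀ j, Measurable (h j))
    (hh_law : ∀ j, HasLaw (h j) (complexGaussianVec T) P) (hh_indep : iIndepFun h P)
    -- fading from the D2D transmitters to the typical cellular user: independent, Rayleigh
    (e : ℕ → Ω → ℂ) (he : ∀ j, Measurable (e j))
    (he_law : ∀ j, HasLaw (e j) complexGaussian P) (he_indep : iIndepFun e P)
    -- user location, transmitter locations, channels and fading are mutually independent
    (hz_indep : IndepFun z (fun ω => ((fun j => x j ω), (fun j => h j ω), (fun j => e j ω))) P)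
    (hx_indep : IndepFun (fun ω j => x j ω) (fun ω => ((fun j => h j ω), (fun j => e j ω))) P)
    (hhe_indep : IndepFun (fun ω j => h j ω) (fun ω j => e j ω) P) :
    Integrable (fun ω => coverageTerm (T - U) (N₀ / Ad) lam Pd αd
        (β / zetaPower Ac Pc U * Ad * dist (z ω) 0 ^ αc)) P ∧
      P.real {ω | ENNReal.ofReal β ≤
          cellularSINR Ad (zetaPower Ac Pc U) αc N₀
            (zfGain (fun j => h j ω) ⟨0, hU⟩) (dist (z ω) 0)
            (d2dInterference Pd αd (fun j => x j ω) (fun j => e j ω) (z ω))} =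
        ∫ ω, coverageTerm (T - U) (N₀ / Ad) lam Pd αd
          (β / zetaPower Ac Pc U * Ad * dist (z ω) 0 ^ αc) ∂P := by
  have hζ : 0 < zetaPower Ac Pc U := by
    have : (0 : ℝ) < U := by exact_mod_cast hU
    rw [zetaPower]
    positivity
  rcases hβ.eq_or_lt with rfl | hβ
  -- For `β = 0` the event is certain and `s = 0`, so both sides equal `1`.
  · simp [coverageTerm_zero _ _ _ _ (two_pos.trans hαd)]
  obtain ⟨n, rfl⟩ : ∃ n, U = n + 1 := ⟨U - 1, by omega⟩
  set ζ := zetaPower Ac Pc (n + 1)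
  set Y : Ω → (ℕ → Plane) × (Fin (n + 1) → Fin T → ℂ) × (ℕ → ℂ) :=
    fun ω => ((fun j => x j ω), (fun j => h j ω), (fun j => e j ω)) with hY
  have hYm : Measurable Y := (measurable_pi_lambda _ hx.measurable).prodMk
    ((measurable_pi_lambda _ hh).prodMk (measurable_pi_lambda _ he))
  set S : Set (Plane × (ℕ → Plane) × (Fin (n + 1) → Fin T → ℂ) × (ℕ → ℂ)) :=
    {q | ENNReal.ofReal β ≤ cellularSINR Ad ζ αc N₀ (zfGain q.2.2.1 0) (dist q.1 0)
      (d2dInterference Pd αd q.2.1 q.2.2.2 q.1)} with hS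
  have hSm : MeasurableSet S := by
    have h1 : Measurable fun q : Plane × (ℕ → Plane) × (Fin (n + 1) → Fin T → ℂ) × (ℕ → ℂ) =>
        zfGain q.2.2.1 0 := (measurable_zfGain 0).comp (by fun_prop)
    have h2 : Measurable fun q : Plane × (ℕ → Plane) × (Fin (n + 1) → Fin T → ℂ) × (ℕ → ℂ) =>
        d2dInterference Pd αd q.2.1 q.2.2.2 q.1 :=
      measurable_d2dInterference Pd αd measurable_snd.fst measurable_snd.snd.snd measurable_fst
    refine measurableSet_le measurable_const ?_
    unfold cellularSINR
    fun_prop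
  -- `Q z₀` is the coverage probability of a user at `z₀`. It agrees a.s. with the coverage term,
  -- which is therefore integrable, being a.s. bounded by `1`.
  set Q : Plane → ℝ≥0∞ := fun z₀ => P.map Y (Prod.mk z₀ ⁻¹' S) with hQ
  have : IsProbabilityMeasure (P.map Y) := Measure.isProbabilityMeasure_map hYm.aemeasurable
  have hQm : Measurable Q := measurable_measure_prodMk_left hSm
  have hQ' : ∀ z₀, Q z₀ = P {ω | (z₀, Y ω) ∈ S} := fun z₀ =>
    Measure.map_apply hYm (measurable_prodMk_left hSm)
  -- The conditional formula needs `s > 0`, hence a user away from the base station; the uniform law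
  -- has no atom there.
  have hz0 : ∀ᵐ ω ∂P, z ω ≠ 0 := by
    refine ae_of_ae_map hz.aemeasurable (p := fun w => w ≠ 0) ?_
    rw [hz_law.map_eq]
    exact cond_absolutelyContinuous.ae_le (compl_mem_ae_iff.2 (measure_singleton (0 : Plane)))
  have hcov : ∀ᵐ ω ∂P, coverageTerm (T - (n + 1)) (N₀ / Ad) lam Pd αd
      (β / ζ * Ad * dist (z ω) 0 ^ αc) = (Q (z ω)).toReal := by
    filter_upwards [hz0] with ω hω
    obtain ⟨h1, h2⟩ := measure_le_cellularSINR (αc := αc) hUT hlam hPd hζ hAd hαd hN₀ hβ hx hh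
      hh_law hh_indep he he_law he_indep hx_indep hhe_indep hω
    rw [hQ', ← ENNReal.toReal_ofReal h1, ← h2]
    rfl
  have hint : Integrable (fun ω => (Q (z ω)).toReal) P := by
    refine Integrable.of_bound (C := 1) (hQm.comp hz).ennreal_toReal.aestronglyMeasurable
      (Filter.Eventually.of_forall fun ω => ?_)
    rw [Real.norm_of_nonneg ENNReal.toReal_nonneg]
    exact measureReal_le_one
  refine ⟨hint.congr (hcov.mono fun ω hω => hω.symm), ?_⟩
  rw [integral_congr_ae hcov, integral_toReal (f := fun ω => Q (z ω)) (hQm.comp hz).aemeasurable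
    (Filter.Eventually.of_forall fun ω => measure_lt_top _ _), measureReal_def]
  congr 1
  refine (measure_prodMk_of_indepFun hz hYm hz_indep hSm).trans ?_
  exact lintegral_congr fun ω => (hQ' _).symm
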